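/- Fix $d\ge 0$ and consider real univariate polynomials of degree at most $2d$ (even case, $U=2d+1$, weights $w=(1,1-z^2)$, $(L_1,L_2)=(d+1,d)$) or at most $2d+1$ (odd case, $U=2d+2$, weights $w=(1-z,1+z)$, $(L_1,L_2)=(d+1,d+1)$). Let $z_1,\dots,z_U\in[-1,1]$ be a unisolvent point set for this $U$-dimensional space, let $\mathbf q=(q_1,\dots,q_U)$ be the Lagrange basis ($q_i(z_j)=\delta_{ij}$), and identify polynomials with their coefficient vectors in $\mathbb R^U$ in this basis; $\mathbf 1$ denotes the coefficient vector of the constant polynomial $1$. Let $\Sigma\subset\mathbb R^U$ be the cone of polynomials $w_1\sigma_1+w_2\sigma_2$, where $\sigma_i$ is a sum of squares of polynomials of degree less than $L_i$, and let $\Sigma^*=\{\mathbf y:\mathbf x^{\mathrm T}\mathbf y\ge 0\ \forall \mathbf x\in\Sigma\}$. Let $\mathbf p_i$ be an arbitrary basis of the space of polynomials of degree less than $L_i$, let $\Lambda_i$ be the linear map from $\mathbb R^U$ to the symmetric $L_i\times L_i$ matrices with $\Lambda_i(\mathbf q)=w_i\mathbf p_i\mathbf p_i^{\mathrm T}$,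 and let $\Lambda=\Lambda_1\oplus\Lambda_2$. Let $H(\mathbf x)$ be the Hessian of $f(\mathbf x)=-\ln\det\Lambda(\mathbf x)$ on $(\Sigma^*)^\circ$. A vector $\mathbf x\in(\Sigma^*)^\circ$ is a dual certificate of $\mathbf t\in\Sigma$ if $H(\mathbf x)^{-1}\mathbf t\in\Sigma^*$. Put $\mu=\max_{i}\max_{-1\le z\le1}|q_i(z)|$. Then the following hold. (1) The minimum $k_1^{\mathbf 1}=\min\{\mathbf 1^{\mathrm T}\mathbf v:\mathbf v\in\Sigma^*,\ \|\mathbf v\|_\infty=1\}$ exists, and $k_1^{\mathbf 1}\ge 1/\mu$. (2) There are $s\ge U$, a unisolvent set $\{x_1,\dots,x_s\}\subset[-1,1]$ of $s$ points, and $\alpha_1,\dots,\alpha_s>0$ such that $\mathbf M=\sum_{a=1}^s\alpha_a\mathbf q(x_a)\mathbf q(x_a)^{\mathrm T}$ is the identity matrix; its condition number $\lambda_{\max}(\mathbf M)/\lambda_{\min}(\mathbf M)$ is $1$. (3) For every $\mathbf t\in\Sigma^\circ$ and $\varepsilon>0$ such that $\mathbf t-\varepsilon\mathbf 1$ lies on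 the boundary of $\Sigma$, there is an integer vector $\bar{\mathbf y}\in(\Sigma^*)^\circ\cap\mathbb Z^U$ that is a dual certificate of $\mathbf t$ with $$\|\bar{\mathbf y}\|_\infty\le\frac12+\Big\lceil\tfrac32\sqrt{2d+2}\,\|\mathbf t\|_2\Big\rceil\frac{(2d+2)\mu}{\varepsilon}$$ and $$\log\|\bar{\mathbf y}\|_\infty\le C\big(\log\max(1,d)+\log\|\mathbf t\|_2+\log\mu+\log(1/\varepsilon)\big),$$ where $C>0$ is an absolute constant, independent of the case, $d$, the points $z_i$, the bases $\mathbf p_i$, $\mathbf t$ and $\varepsilon$. -/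

import Mathlib

open Polynomial

namespace WSOS

/-! Univariate weighted sums of squares, for weights `w i` and spaces of polynomials of degree
`< L i` (that is, of degree at most `d i` with `L i = d i + 1`; `L i = 0` is the zero space). -/

/-- The space of polynomials `∑ i, w i * r i` with `deg (r i) ≤ 2 * d i`. -/
noncomputable def space {m : ℕ} (w : Fin m → ℝ[X]) (L : Fin m → ℕ) : Submodule ℝ ℝ[X] :=
  ⨆ i, (degreeLT ℝ (2 * L i - 1)).map (LinearMap.mulLeft ℝ (w i))

/-- The set `S_w` on which all weights are nonnegative. -/
def domain {m : ℕ} (w : Fin m → ℝ[X]) : Set ℝ := {x | ∀ i, 0 ≤ (w i).eval x}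

/-- Every polynomial of `V` is determined by its values on `S`. -/
def Unisolvent (V : Submodule ℝ ℝ[X]) (S : Set ℝ) : Prop :=
  ∀ p ∈ V, ∀ r ∈ V, (∀ x ∈ S, p.eval x = r.eval x) → p = r

/-- `σ` is a sum of finitely many squares of polynomials of degree `< L`. -/
def IsSOS (L : ℕ) (σ : ℝ[X]) : Prop :=
  ∃ (k : ℕ) (r : Fin k → ℝ[X]), (∀ a, r a ∈ degreeLT ℝ L) ∧ σ = ∑ a, r a ^ 2

theorem mul_mem_space {m : ℕ} (w : Fin m → ℝ[X]) (L : Fin m → ℕ) (i : Fin m)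
    (a b : degreeLT ℝ (L i)) : w i * ((a : ℝ[X]) * (b : ℝ[X])) ∈ space w L := by
  refine Submodule.mem_iSup_of_mem i ⟨(a : ℝ[X]) * b, ?_, rfl⟩
  obtain ⟨a, ha⟩ := a
  obtain ⟨b, hb⟩ := b
  simp only [SetLike.mem_coe]
  by_cases ha0 : a = 0
  · simp [ha0]
  by_cases hb0 : b = 0
  · simp [hb0]
  rw [mem_degreeLT, degree_eq_natDegree (by assumption), Nat.cast_lt] at ha hb
  rw [mem_degreeLT, degree_eq_natDegree (mul_ne_zero ha0 hb0), Nat.cast_lt,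
    natDegree_mul ha0 hb0]
  omega

section cone

variable {m U : ℕ} {w : Fin m → ℝ[X]} {L : Fin m → ℕ}

/-- The cone `Σ` of coefficient vectors, in the basis `q`, of the polynomials
`∑ i, w i * σ i` with `σ i` a sum of squares of polynomials of degree `< L i`. -/
def cone (q : Module.Basis (Fin U) ℝ (space w L)) : Set (Fin U → ℝ) :=
  {s | ∃ σ : Fin m → ℝ[X], (∀ i, IsSOS (L i) (σ i)) ∧
    ∑ u, s u • (q u : ℝ[X]) = ∑ i, w i * σ i}

/-- The dual cone of a set of vectors. -/
def dual (K : Set (Fin U → ℝ)) : Set (Fin U → ℝ) := {y | ∀ x ∈ K, 0 ≤ x ⬝ᵥ y}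

/-- The block `Λ i`: its `(j, k)` entry is the linear combination of the entries of `v` that
gives `w i * p i j * p i k` when it is applied to the basis polynomials `q`. -/
noncomputable def lamBlock (q : Module.Basis (Fin U) ℝ (space w L))
    (p : ∀ i, Module.Basis (Fin (L i)) ℝ (degreeLT ℝ (L i))) (i : Fin m) (v : Fin U → ℝ) :
    Matrix (Fin (L i)) (Fin (L i)) ℝ :=
  Matrix.of fun j k =>
    ∑ u, q.repr ⟨w i * ((p i j : ℝ[X]) * (p i k : ℝ[X])), mul_mem_space w L i _ _⟩ u * v u

/-- The block diagonal matrix `Λ v`. -/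
noncomputable def lam (q : Module.Basis (Fin U) ℝ (space w L))
    (p : ∀ i, Module.Basis (Fin (L i)) ℝ (degreeLT ℝ (L i))) (v : Fin U → ℝ) :
    Matrix (Σ i, Fin (L i)) (Σ i, Fin (L i)) ℝ :=
  Matrix.blockDiagonal' fun i => lamBlock q p i v

/-- The barrier function `f x = - ln (det (Λ x))`; it is used on the interior of the dual cone. -/
noncomputable def barrier (q : Module.Basis (Fin U) ℝ (space w L))
    (p : ∀ i, Module.Basis (Fin (L i)) ℝ (degreeLT ℝ (L i))) (x : Fin U → ℝ) : ℝ :=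
  -Real.log (lam q p x).det

/-- The Hessian of the barrier function (the matrix of its second partial derivatives). -/
noncomputable def hess (q : Module.Basis (Fin U) ℝ (space w L))
    (p : ∀ i, Module.Basis (Fin (L i)) ℝ (degreeLT ℝ (L i))) (x : Fin U → ℝ) :
    Matrix (Fin U) (Fin U) ℝ :=
  Matrix.of fun a b =>
    fderiv ℝ (fun y => fderiv ℝ (barrier q p) y (Pi.single b 1)) x (Pi.single a 1)

/-- `x` is a dual certificate of `s`. -/
def IsDualCertificate (q : Module.Basis (Fin U) ℝ (space w L))
    (p : ∀ i, Module.Basis (Fin (L i)) ℝ (degreeLT ℝ (L i))) (x s : Fin U → ℝ) : Prop :=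
  s ∈ cone q ∧ x ∈ interior (dual (cone q)) ∧ (hess q p x)⁻¹.mulVec s ∈ dual (cone q)

/-- The values `eᵀ v` over the vectors `v` of the dual cone with `‖v‖_∞ = 1`
(the norm of `Fin U → ℝ` is the maximum norm). -/
def k1Values (q : Module.Basis (Fin U) ℝ (space w L)) (e : Fin U → ℝ) : Set ℝ :=
  {r | ∃ v ∈ dual (cone q), ‖v‖ = 1 ∧ r = e ⬝ᵥ v}

/-- The constant `k₁` belonging to `e`. -/
noncomputable def k1 (q : Module.Basis (Fin U) ℝ (space w L)) (e : Fin U → ℝ) : ℝ :=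
  sInf (k1Values q e)

/-- The vector `q(x)` of the values of the basis polynomials at `x`. -/
noncomputable def basisVec (q : Module.Basis (Fin U) ℝ (space w L)) (x : ℝ) : Fin U → ℝ :=
  fun u => (q u : ℝ[X]).eval x

/-- The matrix `∑ a, α a • q(x a) q(x a)ᵀ`. -/
noncomputable def momentMatrix (q : Module.Basis (Fin U) ℝ (space w L)) {s : ℕ}
    (x α : Fin s → ℝ) : Matrix (Fin U) (Fin U) ℝ :=
  ∑ a, α a • Matrix.vecMulVec (basisVec q (x a)) (basisVec q (x a))

/-- `max_i max_{-1 ≤ x ≤ 1} |q_i(x)|`. -/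
noncomputable def maxAbs (q : Module.Basis (Fin U) ℝ (space w L)) : ℝ :=
  ⨆ u : Fin U, ⨆ x : Set.Icc (-1 : ℝ) 1, |(q u : ℝ[X]).eval (x : ℝ)|

end cone

/-- The condition number `λ_max / λ_min` of a symmetric matrix. -/
noncomputable def cond {U : ℕ} (M : Matrix (Fin U) (Fin U) ℝ) : ℝ :=
  sSup (spectrum ℝ M) / sInf (spectrum ℝ M)

/-! The interval `[-1, 1]`: polynomials of degree at most `2 * d` (`odd = false`) or
`2 * d + 1` (`odd = true`). -/

/-- The weights `1, 1 - X ^ 2` (even case) or `1 - X, 1 + X` (odd case). -/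
noncomputable def weights : Bool → Fin 2 → ℝ[X]
  | false => ![1, 1 - X ^ 2]
  | true => ![1 - X, 1 + X]

/-- The dimensions of the spaces of the two polynomials that are squared: these have degree at
most `d` and `d - 1` in the even case, and `d` and `d` in the odd case. -/
def blockDim : Bool → ℕ → Fin 2 → ℕ
  | false, d => ![d + 1, d]
  | true, d => ![d + 1, d + 1]

/-- The dimension of the space of polynomials. -/
def dim : Bool → ℕ → ℕ
  | false, d => 2 * d + 1
  | true, d => 2 * d + 2

theorem space_eq (odd : Bool) (d : ℕ) :
    space (weights odd) (blockDim odd d) = degreeLT ℝ (dim odd d) := by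
  apply le_antisymm
  · refine iSup_le fun i => ?_
    rintro _ ⟨r, hr, rfl⟩
    simp only [SetLike.mem_coe] at hr
    by_cases h0 : r = 0
    · simp [h0]
    by_cases hw : weights odd i = 0
    · simp [hw]
    rw [mem_degreeLT, degree_eq_natDegree h0, Nat.cast_lt] at hr
    rw [LinearMap.mulLeft_apply, mem_degreeLT, degree_eq_natDegree (mul_ne_zero hw h0),
      Nat.cast_lt, natDegree_mul hw h0]
    have h1 : (weights false 0).natDegree = 0 := by simp [weights]
    have h2 : (weights false 1).natDegree ≤ 2 := by
      simp only [weights, Matrix.cons_val_one, Matrix.cons_val_fin_one]; compute_degree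
    have h3 : (weights true 0).natDegree ≤ 1 := by
      simp only [weights, Matrix.cons_val_zero]; compute_degree
    have h4 : (weights true 1).natDegree ≤ 1 := by
      simp only [weights, Matrix.cons_val_one, Matrix.cons_val_fin_one]; compute_degree
    cases odd <;> fin_cases i <;> simp [blockDim, dim] at hr h1 h2 h3 h4 ⊢ <;> omega
  · rw [degreeLT_eq_span_X_pow, Submodule.span_le]
    intro r hr
    simp only [Finset.coe_image, Set.mem_image, Finset.coe_range, Set.mem_Iio] at hr
    obtain ⟨k, hk, rfl⟩ := hr
    have key : ∀ (i : Fin 2) (j : ℕ), j < 2 * blockDim odd d i - 1 →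
        weights odd i * X ^ j ∈ space (weights odd) (blockDim odd d) := fun i j hj =>
      Submodule.mem_iSup_of_mem i ⟨X ^ j, by
        rw [SetLike.mem_coe, mem_degreeLT, degree_X_pow]; exact_mod_cast hj, rfl⟩
    cases odd
    · simpa [weights] using key 0 k (by simp [blockDim, dim] at hk ⊢; omega)
    · simp only [SetLike.mem_coe]
      rcases Nat.lt_or_ge k (2 * d + 1) with h | h
      · have e : (X ^ k : ℝ[X]) = (1 / 2 : ℝ) • (weights true 0 * X ^ k + weights true 1 * X ^ k) := by
          simp only [weights, Matrix.cons_val_zero, Matrix.cons_val_one, Matrix.cons_val_fin_one]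
          rw [show ((1 - X) * X ^ k + (1 + X) * X ^ k : ℝ[X]) = (2 : ℝ) • X ^ k by
            rw [smul_eq_C_mul, map_ofNat]; ring, smul_smul]
          norm_num
        rw [e]
        exact Submodule.smul_mem _ _ (Submodule.add_mem _
          (key 0 k (by simp [blockDim]; omega)) (key 1 k (by simp [blockDim]; omega)))
      · have hk' : k = 2 * d + 1 := by simp [dim] at hk; omega
        subst hk'
        have e : (X ^ (2 * d + 1) : ℝ[X]) =
            (1 / 2 : ℝ) • (weights true 1 * X ^ (2 * d) - weights true 0 * X ^ (2 * d)) := by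
          simp only [weights, Matrix.cons_val_zero, Matrix.cons_val_one, Matrix.cons_val_fin_one]
          rw [show ((1 + X) * X ^ (2 * d) - (1 - X) * X ^ (2 * d) : ℝ[X]) =
            (2 : ℝ) • X ^ (2 * d + 1) by rw [smul_eq_C_mul, map_ofNat]; ring, smul_smul]
          norm_num
        rw [e]
        exact Submodule.smul_mem _ _ (Submodule.sub_mem _
          (key 1 _ (by simp [blockDim]; omega)) (key 0 _ (by simp [blockDim]; omega)))

/-- The constant one polynomial, as an element of the space. -/
noncomputable def onePoly (odd : Bool) (d : ℕ) : space (weights odd) (blockDim odd d) :=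
  ⟨1, by
    rw [space_eq, mem_degreeLT, degree_one]
    cases odd <;> exact_mod_cast Nat.succ_pos _⟩

/-- The evaluation of the polynomials of the space at the points `z`. -/
noncomputable def evalMap (odd : Bool) (d : ℕ) (z : Fin (dim odd d) → ℝ) :
    space (weights odd) (blockDim odd d) →ₗ[ℝ] (Fin (dim odd d) → ℝ) :=
  (LinearMap.pi fun u => leval (z u)) ∘ₗ (space (weights odd) (blockDim odd d)).subtype

/-- Evaluation at a unisolvent system of points, as a linear equivalence. -/
noncomputable def evalEquiv (odd : Bool) (d : ℕ) (z : Fin (dim odd d) → ℝ)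
    (hz : Unisolvent (space (weights odd) (blockDim odd d)) (Set.range z)) :
    space (weights odd) (blockDim odd d) ≃ₗ[ℝ] (Fin (dim odd d) → ℝ) :=
  LinearEquiv.ofBijective (evalMap odd d z) (by
    have hi : Function.Injective (evalMap odd d z) := fun a b h => Subtype.ext
      (hz a a.2 b b.2 (by rintro _ ⟨u, rfl⟩; exact congrFun h u))
    have e : space (weights odd) (blockDim odd d) ≃ₗ[ℝ] (Fin (dim odd d) → ℝ) :=
      (LinearEquiv.ofEq _ _ (space_eq odd d)).trans (degreeLTEquiv ℝ (dim odd d))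
    have : FiniteDimensional ℝ (space (weights odd) (blockDim odd d)) :=
      Module.Finite.equiv e.symm
    exact ⟨hi, (LinearMap.injective_iff_surjective_of_finrank_eq_finrank e.finrank_eq).1 hi⟩)

/-- The Lagrange interpolation basis at the points `z`. -/
noncomputable def lagrange (odd : Bool) (d : ℕ) (z : Fin (dim odd d) → ℝ)
    (hz : Unisolvent (space (weights odd) (blockDim odd d)) (Set.range z)) :
    Module.Basis (Fin (dim odd d)) ℝ (space (weights odd) (blockDim odd d)) :=
  Module.Basis.ofEquivFun (evalEquiv odd d z hz)

/-- The defining property of the Lagrange basis. -/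
theorem lagrange_eval (odd : Bool) (d : ℕ) (z : Fin (dim odd d) → ℝ)
    (hz : Unisolvent (space (weights odd) (blockDim odd d)) (Set.range z))
    (i j : Fin (dim odd d)) :
    (lagrange odd d z hz i : ℝ[X]).eval (z j) = if i = j then 1 else 0 := by
  have h : evalMap odd d z (lagrange odd d z hz i) = Pi.single i 1 := by
    rw [lagrange, Module.Basis.coe_ofEquivFun]
    exact (evalEquiv odd d z hz).apply_symm_apply _
  have := congrFun h j
  rw [Pi.single_apply] at this
  simp only [eq_comm (a := i)]
  exact this

end WSOS

/-! The barrier `-ln det Λ` is studied through the inner product ⟨A, B⟩_X = tr(X⁻¹AX⁻¹B), whose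
pullback along Λ is the Hessian H. For t in the interior of Σ there is x with t = -∇f(x), that is,
tᵀh = tr(Λ(x)⁻¹Λ(h)) for all h (`exists_gradient_certificate`). The integer certificate is a
rounding y of a multiple N x; three facts make this work.

Every y in the open Dikin ball at N x is a dual certificate (`isDualCertificate_of_near`). With X =
Λ(N x) and Y = Λ(y), the matrix Λ(N⁻¹H(y)⁻¹t) is the orthogonal projection of YX⁻¹Y onto the range
of Λ, in the inner product at Y. Since YX⁻¹Y is as far from Y, measured at Y, as Y is from X,
measured at X, the projection stays in the Dikin ball at Y and is positive semidefinite.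

Rounding stays in that ball (`lamForm_self_le`). The unit vectors are evaluations at the nodes, so
they lie in Σ*, and the local norm of e_a at x is at most tr(Λ(x)⁻¹Λ(e_a)) = t_a. A vector with
entries at most 1/2 then has local norm at most ½√U‖t‖₂, while the ball at N x has radius N in the
norm at x.

The vector x is small. By the Markov–Lukács theorem (`isWSOS_of_nonneg`) μ ± q_u lies in Σ, so |v_u|
≤ μ 1ᵀv on Σ* (`abs_le_maxAbs_mul`). This is the bound k₁ ≥ 1/μ; together with ε 1ᵀx ≤ tᵀx = U it
gives |x_u| ≤ Uμ/ε.

The identity matrix in (2) comes from the nodes z with unit weights. -/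

namespace WSOS

/-! ### The local inner product of the log-det barrier and its Dikin ellipsoids. -/

section localInner

open Matrix

variable {n : Type*} [Fintype n] [DecidableEq n]

/-- The inner product `tr (X⁻¹ A X⁻¹ B)` that the barrier `- ln det` defines at `X`. -/
noncomputable def localInner (X A B : Matrix n n ℝ) : ℝ := (X⁻¹ * A * (X⁻¹ * B)).trace

/-- Conjugation by S = X^(-1/2) moves X to the identity and the local inner product at X to the
Frobenius one. -/
theorem exists_sqrt_inv {X : Matrix n n ℝ} (hX : X.PosDef) :
    ∃ S : Matrix n n ℝ, Sᵀ = S ∧ IsUnit S ∧ S * S = X⁻¹ ∧ S * X * S = 1 := by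
  open scoped MatrixOrder in
  have hS : CFC.sqrt X⁻¹ * CFC.sqrt X⁻¹ = X⁻¹ :=
    CFC.sqrt_mul_sqrt_self _ hX.inv.posSemidef.nonneg
  have hT : (CFC.sqrt X⁻¹)ᵀ = CFC.sqrt X⁻¹ := by
    have := (CFC.sqrt_nonneg X⁻¹).posSemidef.isHermitian
    rwa [IsHermitian, conjTranspose_eq_transpose_of_trivial] at this
  set S := CFC.sqrt X⁻¹
  have hdet : IsUnit X.det := (isUnit_iff_isUnit_det X).1 hX.isUnit
  have h1 : S * (S * X) = 1 := by rw [← mul_assoc, hS, nonsing_inv_mul _ hdet]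
  exact ⟨S, hT, IsUnit.of_mul_eq_one _ h1, hS, mul_eq_one_comm.1 h1⟩

theorem localInner_eq_sum {X S A B : Matrix n n ℝ} (hS : Sᵀ = S) (hSS : S * S = X⁻¹)
    (hB : Bᵀ = B) :
    localInner X A B = ∑ i, ∑ j, (S * A * S) i j * (S * B * S) i j := by
  have hD : (S * B * S)ᵀ = S * B * S := by simp [transpose_mul, hS, hB, mul_assoc]
  have h : localInner X A B = (S * A * S * (S * B * S)).trace := by
    rw [localInner, ← hSS, show S * S * A * (S * S * B) = S * (S * A * S * (S * B)) by
      simp only [mul_assoc], trace_mul_comm]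
    simp only [mul_assoc]
  rw [h, trace]
  refine Finset.sum_congr rfl fun i _ => ?_
  rw [diag_apply, mul_apply]
  refine Finset.sum_congr rfl fun j _ => ?_
  congr 1
  exact congrFun (congrFun hD i) j

theorem localInner_self_nonneg {X A : Matrix n n ℝ} (hX : X.PosDef) (hA : Aᵀ = A) :
    0 ≤ localInner X A A := by
  obtain ⟨S, hS, -, hSS, -⟩ := exists_sqrt_inv hX
  rw [localInner_eq_sum hS hSS hA]
  exact Finset.sum_nonneg fun i _ => Finset.sum_nonneg fun j _ => mul_self_nonneg _

theorem eq_zero_of_localInner_self {X A : Matrix n n ℝ} (hX : X.PosDef) (hA : Aᵀ = A)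
    (h : localInner X A A = 0) : A = 0 := by
  obtain ⟨S, hS, hU, hSS, -⟩ := exists_sqrt_inv hX
  rw [localInner_eq_sum hS hSS hA] at h
  have h0 : S * A * S = 0 := by
    generalize S * A * S = C at h
    ext i j
    have h1 := (Finset.sum_eq_zero_iff_of_nonneg
      fun i _ => Finset.sum_nonneg fun j _ => mul_self_nonneg (C i j)).1 h i (Finset.mem_univ i)
    have h2 := (Finset.sum_eq_zero_iff_of_nonneg fun j _ => mul_self_nonneg (C i j)).1 h1 j
      (Finset.mem_univ j)
    simpa using h2
  have h1 : S * A = 0 := hU.mul_left_eq_zero.1 h0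
  exact hU.mul_right_eq_zero.1 h1

/-- Cauchy-Schwarz. -/
theorem localInner_sq_le {X A B : Matrix n n ℝ} (hX : X.PosDef) (hA : Aᵀ = A) (hB : Bᵀ = B) :
    localInner X A B ^ 2 ≤ localInner X A A * localInner X B B := by
  obtain ⟨S, hS, -, hSS, -⟩ := exists_sqrt_inv hX
  simp only [localInner_eq_sum hS hSS hA, localInner_eq_sum hS hSS hB, ← Fintype.sum_prod_type']
  simpa only [sq] using Finset.sum_mul_sq_le_sq_mul_sq Finset.univ
    (fun p : n × n => (S * A * S) p.1 p.2) (fun p : n × n => (S * B * S) p.1 p.2)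

/-- After conjugation the matrix is a Gram matrix C, so C_ij² ≤ C_ii C_jj; summing over i and j
bounds the squared Frobenius norm by the squared trace. -/
theorem localInner_self_le_trace_sq {X A : Matrix n n ℝ} (hX : X.PosDef) (hA : A.PosSemidef) :
    localInner X A A ≤ (X⁻¹ * A).trace ^ 2 := by
  obtain ⟨S, hS, -, hSS, -⟩ := exists_sqrt_inv hX
  have hAT : Aᵀ = A := by
    have := hA.isHermitian
    rwa [IsHermitian, conjTranspose_eq_transpose_of_trivial] at this
  have htr : (X⁻¹ * A).trace = (S * A * S).trace := by
    rw [← hSS, mul_assoc, trace_mul_comm]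
  have hC : (S * A * S).PosSemidef := by
    have := hA.conjTranspose_mul_mul_same S
    rwa [conjTranspose_eq_transpose_of_trivial, hS] at this
  rw [localInner_eq_sum hS hSS hAT, htr]
  generalize S * A * S = C at hC
  obtain ⟨K, rfl⟩ : ∃ K : Matrix n n ℝ, C = Kᵀ * K := by
    open scoped MatrixOrder in
    obtain ⟨K, hK⟩ := CStarAlgebra.nonneg_iff_eq_star_mul_self.mp hC.nonneg
    exact ⟨K, by rw [hK, star_eq_conjTranspose, conjTranspose_eq_transpose_of_trivial]⟩
  rw [sq, trace, Finset.sum_mul_sum]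
  refine Finset.sum_le_sum fun i _ => Finset.sum_le_sum fun j _ => ?_
  simp only [diag_apply, mul_apply, transpose_apply]
  have := Finset.sum_mul_sq_le_sq_mul_sq Finset.univ (fun k => K k i) (fun k => K k j)
  simpa only [sq] using this

/-- Cauchy-Schwarz for C and v vᵀ: the Frobenius norm dominates the quadratic form. -/
theorem sq_quadratic_le {n : Type*} [Fintype n] (C : Matrix n n ℝ) (v : n → ℝ) :
    (v ⬝ᵥ C *ᵥ v) ^ 2 ≤ (∑ i, ∑ j, C i j * C i j) * (v ⬝ᵥ v) ^ 2 := by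
  have h1 : v ⬝ᵥ C *ᵥ v = ∑ p : n × n, C p.1 p.2 * (v p.1 * v p.2) := by
    rw [Fintype.sum_prod_type, dotProduct]
    refine Finset.sum_congr rfl fun i _ => ?_
    rw [mulVec, dotProduct, Finset.mul_sum]
    exact Finset.sum_congr rfl fun j _ => by ring
  have h2 : (v ⬝ᵥ v) ^ 2 = ∑ p : n × n, (v p.1 * v p.2) ^ 2 := by
    rw [Fintype.sum_prod_type, dotProduct, sq, Finset.sum_mul_sum]
    exact Finset.sum_congr rfl fun i _ => Finset.sum_congr rfl fun j _ => by ring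
  rw [h1, h2, ← Fintype.sum_prod_type']
  simpa only [sq] using Finset.sum_mul_sq_le_sq_mul_sq Finset.univ
    (fun p : n × n => C p.1 p.2) (fun p : n × n => v p.1 * v p.2)

/-- The closed Dikin ellipsoid at a positive definite matrix consists of positive semidefinite
matrices. -/
theorem posSemidef_add {X E : Matrix n n ℝ} (hX : X.PosDef) (hE : Eᵀ = E)
    (h : localInner X E E ≤ 1) : (X + E).PosSemidef := by
  obtain ⟨S, hS, hU, hSS, hSX⟩ := exists_sqrt_inv hX
  rw [localInner_eq_sum hS hSS hE] at h
  rw [← IsUnit.posSemidef_star_left_conjugate_iff hU, star_eq_conjTranspose,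
    conjTranspose_eq_transpose_of_trivial, hS, mul_add, add_mul, hSX]
  refine PosSemidef.of_dotProduct_mulVec_nonneg ?_ fun v => ?_
  · rw [IsHermitian, conjTranspose_eq_transpose_of_trivial]
    simp [transpose_mul, hS, hE, mul_assoc]
  · have h1 := (sq_quadratic_le (S * E * S) v).trans
      (mul_le_of_le_one_left (sq_nonneg _) h)
    have h0 : 0 ≤ v ⬝ᵥ v := Finset.sum_nonneg fun i _ => mul_self_nonneg _
    have := abs_le_of_sq_le_sq' h1 h0
    simp only [star_trivial, add_mulVec, one_mulVec, dotProduct_add]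
    linarith [this.1]

/-- The open Dikin ellipsoid at a positive definite matrix consists of positive definite
matrices. -/
theorem posDef_add {X E : Matrix n n ℝ} (hX : X.PosDef) (hE : Eᵀ = E)
    (h : localInner X E E < 1) : (X + E).PosDef := by
  obtain ⟨S, hS, hU, hSS, hSX⟩ := exists_sqrt_inv hX
  rw [localInner_eq_sum hS hSS hE] at h
  rw [← IsUnit.posDef_star_left_conjugate_iff hU, star_eq_conjTranspose,
    conjTranspose_eq_transpose_of_trivial, hS, mul_add, add_mul, hSX]
  refine PosDef.of_dotProduct_mulVec_pos ?_ fun v hv => ?_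
  · rw [IsHermitian, conjTranspose_eq_transpose_of_trivial]
    simp [transpose_mul, hS, hE, mul_assoc]
  · have h0 : 0 < v ⬝ᵥ v := by simpa using dotProduct_star_self_pos_iff.2 hv
    have h1 := (sq_quadratic_le (S * E * S) v).trans_lt
      (mul_lt_of_lt_one_left (pow_pos h0 2) h)
    have := abs_lt_of_sq_lt_sq' h1 h0.le
    simp only [star_trivial, add_mulVec, one_mulVec, dotProduct_add]
    linarith [this.1]

/-- The distance of `Y` from its image under the Newton step for `X`, measured at `Y`,
is the distance of `Y` from `X`, measured at `X`. -/
theorem localInner_newton {X Y : Matrix n n ℝ} (hX : X.PosDef) (hY : Y.PosDef) :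
    localInner Y (Y * X⁻¹ * Y - Y) (Y * X⁻¹ * Y - Y) = localInner X (Y - X) (Y - X) := by
  have hx : IsUnit X.det := (isUnit_iff_isUnit_det X).1 hX.isUnit
  have hy : IsUnit Y.det := (isUnit_iff_isUnit_det Y).1 hY.isUnit
  have : Y⁻¹ * (Y * X⁻¹ * Y - Y) = X⁻¹ * (Y - X) := by
    rw [mul_sub, mul_sub, nonsing_inv_mul _ hx, nonsing_inv_mul _ hy, mul_assoc,
      nonsing_inv_mul_cancel_left _ _ hy]
  rw [localInner, localInner, this]

end localInner

/-! ### First and second derivatives of `-ln det` along a linear matrix map. -/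

section derivatives

open Matrix

theorem differentiable_entry {n E : Type*} [NormedAddCommGroup E] [NormedSpace ℝ E]
    [FiniteDimensional ℝ E] (Φ : E →ₗ[ℝ] Matrix n n ℝ) (i j : n) :
    Differentiable ℝ fun y => Φ y i j :=
  (LinearMap.toContinuousLinearMap
    (LinearMap.proj (R := ℝ) (φ := fun _ : n => ℝ) j ∘ₗ
      LinearMap.proj (R := ℝ) (φ := fun _ : n => n → ℝ) i ∘ₗ Φ)).differentiable

variable {n : Type*} [Fintype n] [DecidableEq n] {E : Type*} [NormedAddCommGroup E]
  [NormedSpace ℝ E]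

theorem differentiable_det (M : E → Matrix n n ℝ) (hM : ∀ i j, Differentiable ℝ fun y => M y i j) :
    Differentiable ℝ fun y => (M y).det := by
  simp only [det_apply]
  fun_prop

variable [FiniteDimensional ℝ E]

theorem differentiableAt_inv_entry (Φ : E →ₗ[ℝ] Matrix n n ℝ) {x : E} (hx : (Φ x).det ≠ 0)
    (i j : n) : DifferentiableAt ℝ (fun y => (Φ y)⁻¹ i j) x := by
  simp only [inv_def, Ring.inverse_eq_inv', Matrix.smul_apply, smul_eq_mul, adjugate_apply]
  refine DifferentiableAt.mul ((differentiable_det _ (differentiable_entry Φ) x).inv hx)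
    (differentiable_det _ (fun k l => ?_) x)
  simp only [updateRow_apply]
  split_ifs
  · fun_prop
  · exact differentiable_entry Φ k l

/-- Jacobi's formula along a line. -/
theorem hasDerivAt_det_line {M : Matrix n n ℝ} (hM : IsUnit M.det) (A : Matrix n n ℝ) :
    HasDerivAt (fun s : ℝ => (M + s • A).det) (M.det * (M⁻¹ * A).trace) 0 := by
  -- With M factored out, the determinant is a polynomial in s; its terms beyond first order carry a
  -- factor s² and do not affect the derivative at 0.
  have h : ∀ s : ℝ, (M + s • A).det = M.det * (1 + (M⁻¹ * A).trace * s +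
      (det (1 + (X : ℝ[X]) • (M⁻¹ * A).map C)).divX.divX.eval s * s ^ 2) := fun s => by
    rw [← det_one_add_smul, ← det_mul, mul_add, mul_one, mul_smul_comm,
      mul_nonsing_inv_cancel_left _ _ hM]
  simp only [h]
  generalize (det (1 + (X : ℝ[X]) • (M⁻¹ * A).map C)).divX.divX = P
  have h1 := ((((hasDerivAt_id (0 : ℝ)).const_mul (M⁻¹ * A).trace).const_add 1).add
    ((P.hasDerivAt 0).mul ((hasDerivAt_id (0 : ℝ)).pow 2))).const_mul M.det
  refine h1.congr_deriv ?_
  simp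

theorem fderiv_log_det (Φ : E →ₗ[ℝ] Matrix n n ℝ) {x : E} (hx : (Φ x).det ≠ 0) (v : E) :
    fderiv ℝ (fun y => -Real.log (Φ y).det) x v = -((Φ x)⁻¹ * Φ v).trace := by
  have hd : DifferentiableAt ℝ (fun y => -Real.log (Φ y).det) x :=
    ((differentiable_det _ (differentiable_entry Φ) x).log hx).neg
  have h1 := (hd.hasFDerivAt.hasLineDerivAt v)
  have h2 : HasLineDerivAt ℝ (fun y => -Real.log (Φ y).det) (-((Φ x)⁻¹ * Φ v).trace) x v := by
    have h3 := hasDerivAt_det_line (isUnit_iff_ne_zero.2 hx) (Φ v)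
    have h4 := (h3.log (by simpa using hx)).neg
    rw [HasLineDerivAt]
    have e : ∀ s : ℝ, Φ (x + s • v) = Φ x + s • Φ v := fun s => by rw [map_add, map_smul]
    simp only [e]
    refine h4.congr_deriv ?_
    simp [mul_div_cancel_left₀ _ hx]
  exact h1.unique h2

theorem fderiv_trace_inv_mul (Φ : E →ₗ[ℝ] Matrix n n ℝ) {x : E} (hx : (Φ x).det ≠ 0)
    (B : Matrix n n ℝ) (v : E) :
    fderiv ℝ (fun y => -((Φ y)⁻¹ * B).trace) x v = localInner (Φ x) (Φ v) B := by
  have hdt : ∀ B : Matrix n n ℝ, DifferentiableAt ℝ (fun y => ((Φ y)⁻¹ * B).trace) x := fun B => by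
    have := differentiableAt_inv_entry Φ hx
    simp only [trace, diag_apply, mul_apply]
    exact DifferentiableAt.fun_sum fun i _ => DifferentiableAt.fun_sum fun j _ =>
      (this i j).mul_const _
  have h1 := ((hdt B).neg.hasFDerivAt.hasLineDerivAt v)
  refine h1.unique ?_
  set W : ℝ → Matrix n n ℝ := fun s => (Φ (x + s • v))⁻¹
  set g : ℝ → ℝ := fun s => (W s * (Φ v * ((Φ x)⁻¹ * B))).trace
  have hg : DifferentiableAt ℝ g 0 := by
    have hl : DifferentiableAt ℝ (fun s : ℝ => x + s • v) 0 := by fun_prop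
    have hc : DifferentiableAt ℝ (fun y => ((Φ y)⁻¹ * (Φ v * ((Φ x)⁻¹ * B))).trace)
        (x + (0 : ℝ) • v) := by simpa using hdt _
    exact DifferentiableAt.comp (g := fun y => ((Φ y)⁻¹ * (Φ v * ((Φ x)⁻¹ * B))).trace)
      (f := fun s : ℝ => x + s • v) (0 : ℝ) hc hl
  have hev : ∀ᶠ s : ℝ in nhds 0, (Φ (x + s • v)).det ≠ 0 := by
    have hc : Continuous fun s : ℝ => (Φ (x + s • v)).det :=
      (differentiable_det _ (differentiable_entry Φ)).continuous.comp
        (continuous_const.add (continuous_id.smul continuous_const))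
    exact hc.continuousAt.eventually_ne (by simpa using hx)
  -- The resolvent identity turns the trace into a constant plus s * g s near 0. The derivative of s
  -- * g s at 0 is g 0, so g only needs to be differentiable.
  have hder : HasDerivAt (fun s : ℝ => -((Φ x)⁻¹ * B).trace + s * g s)
      (1 * g 0 + 0 * deriv g 0) 0 :=
    ((hasDerivAt_id (0 : ℝ)).mul hg.hasDerivAt).const_add _
  have hval : 1 * g 0 + 0 * deriv g 0 = localInner (Φ x) (Φ v) B := by
    simp [g, W, localInner, mul_assoc]
  rw [hval] at hder
  refine hder.congr_of_eventuallyEq ?_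
  filter_upwards [hev] with s hs
  have hx' : IsUnit (Φ x).det := isUnit_iff_ne_zero.2 hx
  have hs' : IsUnit (Φ (x + s • v)).det := isUnit_iff_ne_zero.2 hs
  have key : (Φ x)⁻¹ = W s + s • (W s * Φ v * (Φ x)⁻¹) := by
    have : W s * Φ (x + s • v) * (Φ x)⁻¹ = W s + s • (W s * Φ v * (Φ x)⁻¹) := by
      rw [map_add, map_smul, mul_add, add_mul, mul_nonsing_inv_cancel_right _ _ hx',
        mul_smul_comm, smul_mul_assoc]
    rw [← this, nonsing_inv_mul _ hs', one_mul]
  have h5 : ((Φ x)⁻¹ * B).trace = (W s * B).trace + s * g s := by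
    conv_lhs => rw [key]
    rw [add_mul, trace_add, smul_mul_assoc, trace_smul, smul_eq_mul]
    simp only [g, mul_assoc]
  change -(W s * B).trace = _
  rw [h5]
  ring

/-- The second derivative of the barrier `- ln det`. -/
theorem fderiv_fderiv_log_det (Φ : E →ₗ[ℝ] Matrix n n ℝ) {x : E} (hx : (Φ x).det ≠ 0) (u v : E) :
    fderiv ℝ (fun y => fderiv ℝ (fun y => -Real.log (Φ y).det) y v) x u =
      localInner (Φ x) (Φ u) (Φ v) := by
  rw [← fderiv_trace_inv_mul Φ hx]
  congr 1
  refine Filter.EventuallyEq.fderiv_eq ?_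
  have hc : Continuous fun y => (Φ y).det :=
    (differentiable_det _ (differentiable_entry Φ)).continuous
  filter_upwards [hc.continuousAt.eventually_ne hx] with y hy
  exact fderiv_log_det Φ hy v

end derivatives

/-! ### The Markov–Lukács theorem on [-1, 1]. -/

section markovLukacs

theorem IsSOS.zero (L : ℕ) : IsSOS L 0 := ⟨0, fun a => a.elim0, fun a => a.elim0, by simp⟩

theorem IsSOS.sq {L : ℕ} {r : ℝ[X]} (h : r ∈ degreeLT ℝ L) : IsSOS L (r ^ 2) :=
  ⟨1, fun _ => r, fun _ => h, by simp⟩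

theorem IsSOS.add {L : ℕ} {σ τ : ℝ[X]} (hσ : IsSOS L σ) (hτ : IsSOS L τ) : IsSOS L (σ + τ) := by
  obtain ⟨k, r, hr, rfl⟩ := hσ
  obtain ⟨l, s, hs, rfl⟩ := hτ
  refine ⟨k + l, Fin.append r s, fun a => ?_, by simp [Fin.sum_univ_add]⟩
  refine Fin.addCases (fun i => ?_) (fun i => ?_) a
  · simpa using hr i
  · simpa using hs i

theorem mul_mem_degreeLT {L e : ℕ} {a r : ℝ[X]} (ha : a.natDegree ≤ e) (hr : r ∈ degreeLT ℝ L) :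
    a * r ∈ degreeLT ℝ (L + e) := by
  rcases eq_or_ne a 0 with rfl | ha0
  · simp
  rcases eq_or_ne r 0 with rfl | hr0
  · simp
  rw [mem_degreeLT, degree_eq_natDegree hr0, Nat.cast_lt] at hr
  rw [mem_degreeLT, degree_eq_natDegree (mul_ne_zero ha0 hr0), Nat.cast_lt,
    natDegree_mul ha0 hr0]
  omega

theorem IsSOS.sq_mul {L e : ℕ} {a σ : ℝ[X]} (ha : a.natDegree ≤ e) (hσ : IsSOS L σ) :
    IsSOS (L + e) (a ^ 2 * σ) := by
  obtain ⟨k, r, hr, rfl⟩ := hσ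
  exact ⟨k, fun i => a * r i, fun i => mul_mem_degreeLT ha (hr i), by
    simp only [Finset.mul_sum, mul_pow]⟩

theorem IsSOS.C {L : ℕ} (hL : 0 < L) {c : ℝ} (hc : 0 ≤ c) : IsSOS L (C c) := by
  have := IsSOS.sq (L := L) (r := Polynomial.C (Real.sqrt c))
    (mem_degreeLT.2 (degree_C_le.trans_lt (by exact_mod_cast hL)))
  rwa [← C_pow, Real.sq_sqrt hc] at this

/-- The polynomials `σ + (1 - X²) τ` (of degree at most `n = 2 d`) or `(1 - X) σ + (1 + X) τ`
(of degree at most `n = 2 d + 1`). -/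
inductive IsWSOS : ℕ → ℝ[X] → Prop
  | even (d : ℕ) {σ τ : ℝ[X]} (hσ : IsSOS (d + 1) σ) (hτ : IsSOS d τ) :
      IsWSOS (2 * d) (σ + (1 - X ^ 2) * τ)
  | odd (d : ℕ) {σ τ : ℝ[X]} (hσ : IsSOS (d + 1) σ) (hτ : IsSOS (d + 1) τ) :
      IsWSOS (2 * d + 1) ((1 - X) * σ + (1 + X) * τ)

theorem isWSOS_even {d : ℕ} {p : ℝ[X]} :
    IsWSOS (2 * d) p ↔ ∃ σ τ, IsSOS (d + 1) σ ∧ IsSOS d τ ∧ p = σ + (1 - X ^ 2) * τ := by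
  constructor
  · intro h
    generalize hn : 2 * d = n at h
    cases h with
    | even e hσ hτ =>
      obtain rfl : d = e := by omega
      exact ⟨_, _, hσ, hτ, rfl⟩
    | odd e hσ hτ => omega
  · rintro ⟨σ, τ, hσ, hτ, rfl⟩
    exact .even d hσ hτ

theorem isWSOS_odd {d : ℕ} {p : ℝ[X]} :
    IsWSOS (2 * d + 1) p ↔
      ∃ σ τ, IsSOS (d + 1) σ ∧ IsSOS (d + 1) τ ∧ p = (1 - X) * σ + (1 + X) * τ := by
  constructor
  · intro h
    generalize hn : 2 * d + 1 = n at h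
    cases h with
    | even e hσ hτ => omega
    | odd e hσ hτ =>
      obtain rfl : d = e := by omega
      exact ⟨_, _, hσ, hτ, rfl⟩
  · rintro ⟨σ, τ, hσ, hτ, rfl⟩
    exact .odd d hσ hτ

theorem IsWSOS.zero (n : ℕ) : IsWSOS n 0 := by
  obtain ⟨d, rfl | rfl⟩ := n.even_or_odd'
  · exact isWSOS_even.2 ⟨0, 0, .zero _, .zero _, by simp⟩
  · exact isWSOS_odd.2 ⟨0, 0, .zero _, .zero _, by simp⟩

theorem IsWSOS.add {n : ℕ} {p r : ℝ[X]} (hp : IsWSOS n p) (hr : IsWSOS n r) :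
    IsWSOS n (p + r) := by
  obtain ⟨d, rfl | rfl⟩ := n.even_or_odd'
  · obtain ⟨a, b, ha, hb, rfl⟩ := isWSOS_even.1 hp
    obtain ⟨a', b', ha', hb', rfl⟩ := isWSOS_even.1 hr
    exact isWSOS_even.2 ⟨_, _, ha.add ha', hb.add hb', by ring⟩
  · obtain ⟨a, b, ha, hb, rfl⟩ := isWSOS_odd.1 hp
    obtain ⟨a', b', ha', hb', rfl⟩ := isWSOS_odd.1 hr
    exact isWSOS_odd.2 ⟨_, _, ha.add ha', hb.add hb', by ring⟩

theorem IsWSOS.C (n : ℕ) {c : ℝ} (hc : 0 ≤ c) : IsWSOS n (C c) := by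
  obtain ⟨d, rfl | rfl⟩ := n.even_or_odd'
  · exact isWSOS_even.2 ⟨_, 0, .C (Nat.succ_pos d) hc, .zero _, by simp⟩
  · have hc2 : 0 ≤ c / 2 := by positivity
    refine isWSOS_odd.2 ⟨_, _, .C (Nat.succ_pos d) hc2, .C (Nat.succ_pos d) hc2, ?_⟩
    have : (Polynomial.C c : ℝ[X]) = Polynomial.C (c / 2) + Polynomial.C (c / 2) := by
      rw [← C_add, add_halves]
    rw [this]
    ring

theorem IsWSOS.sq_mul {n : ℕ} {a p : ℝ[X]} (ha : a.natDegree ≤ 1) (hp : IsWSOS n p) :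
    IsWSOS (n + 2) (a ^ 2 * p) := by
  obtain ⟨d, rfl | rfl⟩ := n.even_or_odd'
  · obtain ⟨σ, τ, hσ, hτ, rfl⟩ := isWSOS_even.1 hp
    exact isWSOS_even (d := d + 1).2 ⟨_, _, hσ.sq_mul ha, hτ.sq_mul ha, by ring⟩
  · obtain ⟨σ, τ, hσ, hτ, rfl⟩ := isWSOS_odd.1 hp
    exact isWSOS_odd (d := d + 1).2 ⟨_, _, hσ.sq_mul ha, hτ.sq_mul ha, by ring⟩

theorem natDegree_one_sub_X_le : (1 - X : ℝ[X]).natDegree ≤ 1 := by compute_degree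

theorem natDegree_one_add_X_le : (1 + X : ℝ[X]).natDegree ≤ 1 := by compute_degree

/-- A linear weight switches parity: (1-X)(1-X²)τ = (1+X)·(1-X)²τ in one direction, and (1-X)·(1-X)σ
= (1-X)²σ with (1-X)(1+X)τ = (1-X²)τ in the other. -/
theorem IsWSOS.one_sub_X_mul {n : ℕ} {p : ℝ[X]} (hp : IsWSOS n p) :
    IsWSOS (n + 1) ((1 - X) * p) := by
  obtain ⟨d, rfl | rfl⟩ := n.even_or_odd'
  · obtain ⟨σ, τ, hσ, hτ, rfl⟩ := isWSOS_even.1 hp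
    exact isWSOS_odd.2 ⟨_, _, hσ, hτ.sq_mul natDegree_one_sub_X_le, by ring⟩
  · obtain ⟨σ, τ, hσ, hτ, rfl⟩ := isWSOS_odd.1 hp
    exact isWSOS_even (d := d + 1).2 ⟨_, _, hσ.sq_mul natDegree_one_sub_X_le, hτ, by ring⟩

theorem IsWSOS.one_add_X_mul {n : ℕ} {p : ℝ[X]} (hp : IsWSOS n p) :
    IsWSOS (n + 1) ((1 + X) * p) := by
  obtain ⟨d, rfl | rfl⟩ := n.even_or_odd'
  · obtain ⟨σ, τ, hσ, hτ, rfl⟩ := isWSOS_even.1 hp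
    exact isWSOS_odd.2 ⟨_, _, hτ.sq_mul natDegree_one_add_X_le, hσ, by ring⟩
  · obtain ⟨σ, τ, hσ, hτ, rfl⟩ := isWSOS_odd.1 hp
    exact isWSOS_even (d := d + 1).2 ⟨_, _, hτ.sq_mul natDegree_one_add_X_le, hσ, by ring⟩

theorem natDegree_quotient_le {n : ℕ} {g : ℝ[X]} {r : ℝ}
    (h : ((X - Polynomial.C r) * g).natDegree ≤ n + 1) : g.natDegree ≤ n := by
  rcases eq_or_ne g 0 with rfl | hg
  · simp
  rw [natDegree_mul (X_sub_C_ne_zero r) hg, natDegree_X_sub_C] at h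
  omega

/-- Dividing by X - r loses the sign at r; continuity recovers it. -/
theorem eval_nonneg_of_dense {g : ℝ[X]} {s : Set ℝ} (h : ∀ x ∈ s, 0 ≤ g.eval x) {x : ℝ}
    (hx : x ∈ closure s) : 0 ≤ g.eval x :=
  closure_minimal h (isClosed_le continuous_const g.continuous) hx

/-- The theorem of Markov and Lukács: a polynomial of degree at most `n` that is nonnegative on
`[-1, 1]` is a weighted sum of squares. -/
theorem isWSOS_of_nonneg (n : ℕ) (p : ℝ[X]) (hn : p.natDegree ≤ n)
    (hp : ∀ x ∈ Set.Icc (-1 : ℝ) 1, 0 ≤ p.eval x) : IsWSOS n p := by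
  induction n using Nat.strong_induction_on generalizing p with
  | _ n ih =>
  obtain ⟨r, hr, hmin⟩ := isCompact_Icc.exists_isMinOn (s := Set.Icc (-1 : ℝ) 1)
    ⟨0, by norm_num⟩ p.continuous.continuousOn
  -- Subtracting the minimum creates a root in the interval. An endpoint root is divided out with
  -- its linear weight, an interior root with a square, and induction on the degree applies.
  suffices h : IsWSOS n (p - C (p.eval r)) by
    simpa using h.add (IsWSOS.C n (hp r hr))
  have hroot : IsRoot (p - C (p.eval r)) r := by simp
  have hq : ∀ x ∈ Set.Icc (-1 : ℝ) 1, 0 ≤ (p - C (p.eval r)).eval x := fun x hx => by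
    simpa using hmin hx
  have hdeg : (p - C (p.eval r)).natDegree ≤ n := by rwa [natDegree_sub_C]
  generalize p - C (p.eval r) = f at hroot hq hdeg
  obtain ⟨g, rfl⟩ := dvd_iff_isRoot.2 hroot
  rcases eq_or_ne g 0 with rfl | hg0
  · simpa using IsWSOS.zero n
  obtain ⟨n, rfl⟩ : ∃ m, n = m + 1 := ⟨n - 1, by
    rw [natDegree_mul (X_sub_C_ne_zero r) hg0, natDegree_X_sub_C] at hdeg; omega⟩
  have hg := natDegree_quotient_le hdeg
  simp only [eval_mul, eval_sub, eval_X, eval_C] at hq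
  have hne : (-1 : ℝ) ≠ 1 := by norm_num
  rcases eq_or_lt_of_le hr.1 with h1 | h1
  · subst h1
    have hg' : ∀ x ∈ Set.Icc (-1 : ℝ) 1, 0 ≤ g.eval x := fun x hx =>
      eval_nonneg_of_dense (s := Set.Ioo (-1) 1) (fun y hy =>
        nonneg_of_mul_nonneg_right (hq y ⟨hy.1.le, hy.2.le⟩) (by linarith [hy.1]))
        (by rwa [closure_Ioo hne])
    convert (ih n (by omega) g hg hg').one_add_X_mul using 2
    simp [add_comm]
  rcases eq_or_lt_of_le hr.2 with h2 | h2
  · subst h2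
    have hg' : ∀ x ∈ Set.Icc (-1 : ℝ) 1, 0 ≤ (-g).eval x := fun x hx =>
      eval_nonneg_of_dense (s := Set.Ioo (-1) 1) (fun y hy => by
        rw [eval_neg]
        exact nonneg_of_mul_nonneg_right (a := 1 - y)
          (by linarith [hq y ⟨hy.1.le, hy.2.le⟩]) (by linarith [hy.2]))
        (by rwa [closure_Ioo hne])
    convert (ih n (by omega) (-g) (by rwa [natDegree_neg]) hg').one_sub_X_mul using 1
    simp only [map_one]
    ring
  have hright : ∀ x ∈ Set.Icc r 1, 0 ≤ g.eval x := fun x hx =>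
    eval_nonneg_of_dense (s := Set.Ioo r 1) (fun y hy =>
      nonneg_of_mul_nonneg_right (hq y ⟨by linarith [hy.1], hy.2.le⟩) (by linarith [hy.1]))
      (by rwa [closure_Ioo h2.ne])
  have hleft : ∀ x ∈ Set.Icc (-1) r, 0 ≤ (-g).eval x := fun x hx =>
    eval_nonneg_of_dense (s := Set.Ioo (-1) r) (fun y hy => by
      rw [eval_neg]
      exact nonneg_of_mul_nonneg_right (a := r - y)
        (by linarith [hq y ⟨hy.1.le, by linarith [hy.2]⟩]) (by linarith [hy.2]))
      (by rwa [closure_Ioo h1.ne])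
  -- At an interior root of a nonnegative polynomial the quotient changes sign, so the root is
  -- double.
  have hgr : IsRoot g r := by
    have a := hright r ⟨le_rfl, h2.le⟩
    have b := hleft r ⟨h1.le, le_rfl⟩
    rw [eval_neg] at b
    exact le_antisymm (by linarith) a
  obtain ⟨k, rfl⟩ := dvd_iff_isRoot.2 hgr
  have hk0 : k ≠ 0 := right_ne_zero_of_mul hg0
  obtain ⟨n, rfl⟩ : ∃ m, n = m + 1 := ⟨n - 1, by
    rw [natDegree_mul (X_sub_C_ne_zero r) hk0, natDegree_X_sub_C] at hg; omega⟩
  have hk := natDegree_quotient_le hg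
  simp only [eval_mul, eval_sub, eval_X, eval_C, eval_neg] at hright hleft
  have hk' : ∀ x ∈ Set.Icc (-1 : ℝ) 1, 0 ≤ k.eval x := fun x hx => by
    rcases le_total r x with h | h
    · exact eval_nonneg_of_dense (s := Set.Ioo r 1) (fun y hy =>
        nonneg_of_mul_nonneg_right (hright y ⟨hy.1.le, hy.2.le⟩) (by linarith [hy.1]))
        (by rw [closure_Ioo h2.ne]; exact ⟨h, hx.2⟩)
    · exact eval_nonneg_of_dense (s := Set.Ioo (-1) r) (fun y hy =>
        nonneg_of_mul_nonneg_right (a := r - y)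
          (by linarith [hleft y ⟨hy.1.le, hy.2.le⟩]) (by linarith [hy.2]))
        (by rw [closure_Ioo h1.ne]; exact ⟨hx.1, h⟩)
  convert (ih n (by omega) k hk hk').sq_mul (natDegree_X_sub_C_le r) using 1
  ring

end markovLukacs

/-! ### The dual cone as a spectrahedron, gradient certificates and dual certificates. -/

section dualCone

open Matrix

variable {m U : ℕ} {w : Fin m → ℝ[X]} {L : Fin m → ℕ} (q : Module.Basis (Fin U) ℝ (space w L))
  (p : ∀ i, Module.Basis (Fin (L i)) ℝ (degreeLT ℝ (L i)))

/-- The linear functional on polynomials whose values on the basis `q` are given by `v`. -/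
noncomputable def functional (v : Fin U → ℝ) : space w L →ₗ[ℝ] ℝ where
  toFun r := q.repr r ⬝ᵥ v
  map_add' r s := by simp [add_dotProduct]
  map_smul' c r := by simp [smul_dotProduct]

theorem functional_apply (v : Fin U → ℝ) (r : space w L) : functional q v r = q.repr r ⬝ᵥ v := rfl

theorem functional_basisVec (x : ℝ) (r : space w L) :
    functional q (basisVec q x) r = (r : ℝ[X]).eval x := by
  conv_rhs => rw [← q.sum_repr r]
  rw [functional_apply, dotProduct, Submodule.coe_sum, eval_finsetSum]
  exact Finset.sum_congr rfl fun u _ => by simp [basisVec]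

theorem repr_mem_cone_iff (r : space w L) :
    (q.repr r : Fin U → ℝ) ∈ cone q ↔
      ∃ σ : Fin m → ℝ[X], (∀ i, IsSOS (L i) (σ i)) ∧ (r : ℝ[X]) = ∑ i, w i * σ i := by
  have : ∑ u, q.repr r u • (q u : ℝ[X]) = r := by
    conv_rhs => rw [← q.sum_repr r]
    rw [Submodule.coe_sum]
    rfl
  simp only [cone, Set.mem_ofPred_eq, this]

/-- The polynomial `w i * a ^ 2`. -/
noncomputable def weightedSq (w : Fin m → ℝ[X]) (L : Fin m → ℕ) (i : Fin m)
    (a : degreeLT ℝ (L i)) : space w L :=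
  ⟨w i * ((a : ℝ[X]) * a), mul_mem_space w L i a a⟩

theorem repr_weightedSq_mem_cone (i : Fin m) (a : degreeLT ℝ (L i)) :
    (q.repr (weightedSq w L i a) : Fin U → ℝ) ∈ cone q := by
  classical
  rw [repr_mem_cone_iff]
  refine ⟨Pi.single i ((a : ℝ[X]) ^ 2), fun j => ?_, ?_⟩
  · by_cases h : j = i
    · subst h
      simpa using ⟨1, fun _ => (a : ℝ[X]), fun _ => a.2, by simp⟩
    · rw [Pi.single_eq_of_ne h]
      exact ⟨0, fun b => b.elim0, fun b => b.elim0, by simp⟩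
  · rw [Finset.sum_eq_single i (fun j _ h => by rw [Pi.single_eq_of_ne h, mul_zero])
      (fun h => absurd (Finset.mem_univ i) h), Pi.single_eq_same, weightedSq, sq]

theorem mem_dual_iff_functional (v : Fin U → ℝ) :
    v ∈ dual (cone q) ↔ ∀ i a, 0 ≤ functional q v (weightedSq w L i a) := by
  constructor
  · exact fun h i a => h _ (repr_weightedSq_mem_cone q i a)
  · rintro h s ⟨σ, hσ, hs⟩
    choose k r hr hσr using hσ
    have e : ∑ u, s u • q u = ∑ i, ∑ a, weightedSq w L i ⟨r i a, hr i a⟩ := by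
      apply Subtype.ext
      simp only [Submodule.coe_sum, Submodule.coe_smul, weightedSq]
      rw [hs]
      refine Finset.sum_congr rfl fun i _ => ?_
      rw [hσr, Finset.mul_sum]
      exact Finset.sum_congr rfl fun a _ => by rw [sq]
    have e2 : s ⬝ᵥ v = functional q v (∑ u, s u • q u) := by
      rw [functional_apply, q.repr_sum_self]
    rw [e2, e, map_sum]
    refine Finset.sum_nonneg fun i _ => ?_
    rw [map_sum]
    exact Finset.sum_nonneg fun a _ => h i _

theorem dotProduct_lamBlock (i : Fin m) (v : Fin U → ℝ) (c : Fin (L i) → ℝ) :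
    c ⬝ᵥ lamBlock q p i v *ᵥ c =
      functional q v (weightedSq w L i (∑ j, c j • p i j)) := by
  have e : weightedSq w L i (∑ j, c j • p i j) = ∑ j, ∑ k, (c j * c k) •
      (⟨w i * ((p i j : ℝ[X]) * p i k), mul_mem_space w L i _ _⟩ : space w L) := by
    apply Subtype.ext
    simp only [weightedSq, Submodule.coe_sum, Submodule.coe_smul]
    rw [Finset.sum_mul_sum, Finset.mul_sum]
    refine Finset.sum_congr rfl fun j _ => ?_
    rw [Finset.mul_sum]
    refine Finset.sum_congr rfl fun k _ => ?_
    simp only [smul_eq_C_mul, C_mul]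
    ring
  rw [e, map_sum, dotProduct]
  refine Finset.sum_congr rfl fun j _ => ?_
  rw [map_sum, mulVec, dotProduct, Finset.mul_sum]
  refine Finset.sum_congr rfl fun k _ => ?_
  rw [map_smul, functional_apply, smul_eq_mul, lamBlock, of_apply, dotProduct]
  ring

theorem dotProduct_lam (v : Fin U → ℝ) (c : (Σ i, Fin (L i)) → ℝ) :
    c ⬝ᵥ lam q p v *ᵥ c =
      ∑ i, functional q v (weightedSq w L i (∑ j, c ⟨i, j⟩ • p i j)) := by
  rw [dotProduct, Fintype.sum_sigma]
  refine Finset.sum_congr rfl fun i _ => ?_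
  rw [← dotProduct_lamBlock q p i v fun j => c ⟨i, j⟩, dotProduct]
  refine Finset.sum_congr rfl fun j _ => ?_
  congr 1
  rw [mulVec, mulVec, dotProduct, dotProduct, Fintype.sum_sigma, Finset.sum_eq_single i]
  · simp [lam, blockDiagonal'_apply_eq]
  · intro k _ hk
    exact Finset.sum_eq_zero fun l _ => by
      rw [lam, blockDiagonal'_apply_ne _ _ _ hk.symm, zero_mul]
  · exact fun h => absurd (Finset.mem_univ i) h

theorem lam_transpose (v : Fin U → ℝ) : (lam q p v)ᵀ = lam q p v := by
  rw [lam, blockDiagonal'_transpose]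
  congr 1
  funext i
  ext j k
  simp only [lamBlock, transpose_apply, of_apply, mul_comm (p i j : ℝ[X])]

theorem lam_isHermitian (v : Fin U → ℝ) : (lam q p v).IsHermitian := by
  rw [IsHermitian, conjTranspose_eq_transpose_of_trivial, lam_transpose]

/-- The map `lam` as a linear map. -/
noncomputable def lamLinear :
    (Fin U → ℝ) →ₗ[ℝ] Matrix (Σ i, Fin (L i)) (Σ i, Fin (L i)) ℝ where
  toFun := lam q p
  map_add' v v' := by
    rw [lam, lam, lam, ← blockDiagonal'_add]
    congr 1
    funext i
    ext j k
    simp [lamBlock, mul_add, Finset.sum_add_distrib]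
  map_smul' c v := by
    rw [lam, lam, RingHom.id_apply, ← blockDiagonal'_smul]
    congr 1
    funext i
    ext j k
    simp [lamBlock, Finset.mul_sum, mul_left_comm]

theorem lamLinear_apply (v : Fin U → ℝ) : lamLinear q p v = lam q p v := rfl

theorem mem_dual_iff (v : Fin U → ℝ) : v ∈ dual (cone q) ↔ (lam q p v).PosSemidef := by
  classical
  rw [mem_dual_iff_functional]
  constructor
  · refine fun h => PosSemidef.of_dotProduct_mulVec_nonneg (lam_isHermitian q p v) fun c => ?_
    rw [star_trivial, dotProduct_lam]
    exact Finset.sum_nonneg fun i _ => h i _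
  · intro h i a
    -- The test vector holds the coordinates of a in block i and vanishes on the other blocks.
    have := h.dotProduct_mulVec_nonneg fun k => if e : k.1 = i then (p i).repr a (e ▸ k.2) else 0
    rw [star_trivial, dotProduct_lam, Finset.sum_eq_single i] at this
    · simpa [(p i).sum_repr a] using this
    · intro k _ hk
      simp [hk, weightedSq]
      exact map_zero _
    · exact fun h => absurd (Finset.mem_univ i) h

theorem posDef_lam {v : Fin U → ℝ}
    (h : ∀ i (a : degreeLT ℝ (L i)), a ≠ 0 → 0 < functional q v (weightedSq w L i a)) :
    (lam q p v).PosDef := by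
  refine PosDef.of_dotProduct_mulVec_pos (lam_isHermitian q p v) fun c hc => ?_
  rw [star_trivial, dotProduct_lam]
  have h0 : ∀ i a, 0 ≤ functional q v (weightedSq w L i a) := fun i a => by
    rcases eq_or_ne a 0 with rfl | ha
    · rw [show weightedSq w L i 0 = 0 from Subtype.ext (by simp [weightedSq]), map_zero]
    · exact (h i a ha).le
  obtain ⟨⟨i, j⟩, hij⟩ := Function.ne_iff.1 hc
  refine Finset.sum_pos' (fun i _ => h0 i _) ⟨i, Finset.mem_univ i, h i _ fun ha => hij ?_⟩
  exact Fintype.linearIndependent_iff.1 (p i).linearIndependent _ ha j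

theorem isClosed_dual : IsClosed (dual (cone q)) := by
  have : dual (cone q) = ⋂ x ∈ cone q, {y | 0 ≤ x ⬝ᵥ y} := by ext; simp [dual]
  rw [this]
  exact isClosed_biInter fun x _ => isClosed_le continuous_const
    (continuous_const.dotProduct continuous_id)

theorem smul_mem_dual {v : Fin U → ℝ} (hv : v ∈ dual (cone q)) {c : ℝ} (hc : 0 ≤ c) :
    c • v ∈ dual (cone q) := fun x hx => by
  rw [dotProduct_smul, smul_eq_mul]
  exact mul_nonneg hc (hv x hx)

theorem dotProduct_nonneg_of_mem_closure {s v : Fin U → ℝ} (hs : s ∈ closure (cone q))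
    (hv : v ∈ dual (cone q)) : 0 ≤ s ⬝ᵥ v :=
  closure_minimal (s := cone q) (t := {s | 0 ≤ s ⬝ᵥ v}) (fun x hx => hv x hx)
    (isClosed_le continuous_const (continuous_id.dotProduct continuous_const)) hs

theorem continuous_lam : Continuous (lam q p) :=
  (lamLinear q p).continuous_of_finiteDimensional

theorem eventually_posDef {x : Fin U → ℝ} (hx : (lam q p x).PosDef) :
    ∀ᶠ y in nhds x, (lam q p y).PosDef := by
  have hc : Continuous fun y => localInner (lam q p x) (lam q p y - lam q p x)
      (lam q p y - lam q p x) := by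
    have h := (continuous_lam q p).sub (continuous_const (y := lam q p x))
    exact ((continuous_const.matrix_mul h).matrix_mul (continuous_const.matrix_mul h)).matrix_trace
  have h0 : localInner (lam q p x) (lam q p x - lam q p x) (lam q p x - lam q p x) < 1 := by
    simp [localInner]
  filter_upwards [hc.continuousAt.eventually_lt continuousAt_const h0] with y hy
  have := posDef_add hx (by simp [lam_transpose]) hy
  rwa [add_sub_cancel] at this

theorem mem_interior_dual {x : Fin U → ℝ} (hx : (lam q p x).PosDef) :
    x ∈ interior (dual (cone q)) :=
  mem_interior_iff_mem_nhds.2 <| Filter.mem_of_superset (eventually_posDef q p hx)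
    fun _ hy => (mem_dual_iff q p _).2 hy.posSemidef

/-- A small ball around t lies in Σ, so pairing y with t ± (δ/2) e_u bounds each coordinate of y.
This coercivity makes the slices of Σ* compact and makes Λ injective. -/
theorem exists_mul_abs_le {t : Fin U → ℝ} (ht : t ∈ interior (cone q)) :
    ∃ δ > 0, ∀ y ∈ dual (cone q), ∀ u, δ * |y u| ≤ t ⬝ᵥ y := by
  obtain ⟨δ, hδ, hb⟩ := Metric.mem_nhds_iff.1 (mem_interior_iff_mem_nhds.1 ht)
  refine ⟨δ / 2, half_pos hδ, fun y hy u => ?_⟩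
  have key : ∀ c : ℝ, |c| = δ / 2 → 0 ≤ t ⬝ᵥ y + c * y u := fun c hc => by
    have : t + Pi.single u c ∈ cone q := hb (by
      rw [mem_ball_iff_norm, add_sub_cancel_left, Pi.norm_single, Real.norm_eq_abs, hc]
      linarith)
    simpa [add_dotProduct] using hy _ this
  have h1 := key (δ / 2) (abs_of_pos (half_pos hδ))
  have h2 := key (-(δ / 2)) (by rw [abs_neg, abs_of_pos (half_pos hδ)])
  rcases abs_cases (y u) with ⟨h, -⟩ | ⟨h, -⟩ <;> rw [h] <;> linarith

theorem eq_zero_of_lam_eq_zero {t : Fin U → ℝ} (ht : t ∈ interior (cone q)) {v : Fin U → ℝ}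
    (hv : lam q p v = 0) : v = 0 := by
  obtain ⟨δ, hδ, hb⟩ := exists_mul_abs_le q ht
  have h1 : v ∈ dual (cone q) := by rw [mem_dual_iff q p, hv]; exact .zero
  have h2 : -v ∈ dual (cone q) := by
    rw [mem_dual_iff q p, ← lamLinear_apply, map_neg, lamLinear_apply, hv, neg_zero]; exact .zero
  funext u
  have a1 := hb v h1 u
  have a2 := hb (-v) h2 u
  simp only [Pi.neg_apply, abs_neg, dotProduct_neg] at a2
  have : δ * |v u| ≤ 0 := by linarith
  have : |v u| ≤ 0 := nonpos_of_mul_nonpos_right this hδ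
  exact abs_nonpos_iff.1 this

/-- A vector in the interior of the cone is minus the gradient of the barrier at some point. -/
theorem exists_gradient_certificate [Nonempty (Σ i, Fin (L i))] {t v₀ : Fin U → ℝ}
    (ht : t ∈ interior (cone q)) (hv₀ : (lam q p v₀).PosDef) :
    ∃ x, (lam q p x).PosDef ∧ ∀ h, t ⬝ᵥ h = ((lam q p x)⁻¹ * lam q p h).trace := by
  obtain ⟨δ, hδ, hb⟩ := exists_mul_abs_le q ht
  set ν : ℝ := (Fintype.card (Σ i, Fin (L i)) : ℝ) with hν
  have hν0 : 0 < ν := by rw [hν]; exact_mod_cast Fintype.card_pos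
  -- The level ν is the size of Λ. A gradient certificate must satisfy tᵀx = tr(1) = ν, so at this
  -- level the Lagrange multiplier of the maximisation of det Λ equals one.
  set K : Set (Fin U → ℝ) := {y | y ∈ dual (cone q) ∧ t ⬝ᵥ y = ν}
  have hdet : Continuous fun y => (lam q p y).det := (continuous_lam q p).matrix_det
  have hKc : IsCompact K := by
    refine Metric.isCompact_of_isClosed_isBounded ?_ ?_
    · exact (isClosed_dual q).inter (isClosed_eq (continuous_const.dotProduct continuous_id)
        continuous_const)
    · refine (Metric.isBounded_closedBall (x := 0) (r := ν / δ)).subset fun y hy => ?_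
      rw [mem_closedBall_zero_iff, pi_norm_le_iff_of_nonneg (by positivity)]
      intro u
      rw [Real.norm_eq_abs, le_div_iff₀ hδ, mul_comm]
      exact (hb y hy.1 u).trans_eq hy.2
  have hv₀d : v₀ ∈ dual (cone q) := (mem_dual_iff q p _).2 hv₀.posSemidef
  have htv₀ : 0 < t ⬝ᵥ v₀ := by
    obtain ⟨u, hu⟩ : ∃ u, v₀ u ≠ 0 := by
      refine Function.ne_iff.1 (fun h => ?_ : v₀ ≠ 0)
      have := hv₀.det_pos
      rw [h, ← lamLinear_apply, map_zero, det_zero] at this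
      exact lt_irrefl _ this
    exact (mul_pos hδ (abs_pos.2 hu)).trans_le (hb v₀ hv₀d u)
  have hc₀ : 0 < ν / (t ⬝ᵥ v₀) := by positivity
  have hv₁ : (lam q p ((ν / (t ⬝ᵥ v₀)) • v₀)).PosDef := by
    rw [← lamLinear_apply, map_smul]
    exact hv₀.smul hc₀
  have hv₁K : (ν / (t ⬝ᵥ v₀)) • v₀ ∈ K :=
    ⟨smul_mem_dual q hv₀d hc₀.le, by
      rw [dotProduct_smul, smul_eq_mul, div_mul_cancel₀ _ htv₀.ne']⟩
  obtain ⟨x, hxK, hmax⟩ := hKc.exists_isMaxOn ⟨_, hv₁K⟩ hdet.continuousOn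
  have hxdet : 0 < (lam q p x).det := hv₁.det_pos.trans_le (hmax hv₁K)
  have hx : (lam q p x).PosDef :=
    ((mem_dual_iff q p x).1 hxK.1).posDef_iff_det_ne_zero.2 hxdet.ne'
  have hxu : IsUnit (lam q p x).det := isUnit_iff_ne_zero.2 hxdet.ne'
  -- First-order optimality: the maximiser is positive definite, so the line x + s h stays in the
  -- slice for small s, and Jacobi's formula gives the derivative.
  have htan : ∀ h, t ⬝ᵥ h = 0 → ((lam q p x)⁻¹ * lam q p h).trace = 0 := fun h hh => by
    have hd := hasDerivAt_det_line hxu (lam q p h)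
    have hlin : ∀ s : ℝ, lam q p x + s • lam q p h = lam q p (x + s • h) := fun s => by
      simp only [← lamLinear_apply, map_add, map_smul]
    have hloc : IsLocalMax (fun s : ℝ => (lam q p x + s • lam q p h).det) 0 := by
      have hcont : ContinuousAt (fun s : ℝ => x + s • h) 0 := by fun_prop
      have hev : ∀ᶠ y in nhds (x + (0 : ℝ) • h), (lam q p y).PosDef := by
        simpa using eventually_posDef q p hx
      filter_upwards [hcont.eventually hev] with s hs
      simp only [hlin, zero_smul, add_zero]
      exact hmax ⟨(mem_dual_iff q p _).2 hs.posSemidef, by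
        rw [dotProduct_add, dotProduct_smul, hh, hxK.2]; simp⟩
    exact (mul_eq_zero.1 (hloc.hasDerivAt_eq_zero hd)).resolve_left hxdet.ne'
  refine ⟨x, hx, fun h => ?_⟩
  -- A general direction becomes tangent once its component along x is removed.
  have := htan (h - ((t ⬝ᵥ h) / ν) • x) (by
    rw [dotProduct_sub, dotProduct_smul, hxK.2, smul_eq_mul, div_mul_cancel₀ _ hν0.ne', sub_self])
  have e : lam q p (h - ((t ⬝ᵥ h) / ν) • x) = lam q p h - ((t ⬝ᵥ h) / ν) • lam q p x := by
    simp only [← lamLinear_apply, map_sub, map_smul]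
  rw [e, mul_sub, trace_sub, mul_smul_comm, nonsing_inv_mul _ hxu, trace_smul, trace_one, ← hν, smul_eq_mul,
    div_mul_cancel₀ _ hν0.ne'] at this
  linarith

theorem hess_apply {x : Fin U → ℝ} (hx : (lam q p x).PosDef) (a b : Fin U) :
    hess q p x a b =
      localInner (lam q p x) (lam q p (Pi.single a 1)) (lam q p (Pi.single b 1)) :=
  fderiv_fderiv_log_det (lamLinear q p) hx.det_pos.ne' _ _

/-- The local inner product at `X`, pulled back along `lam`. -/
noncomputable def lamForm (X : Matrix (Σ i, Fin (L i)) (Σ i, Fin (L i)) ℝ) :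
    LinearMap.BilinForm ℝ (Fin U → ℝ) :=
  LinearMap.mk₂ ℝ (fun u v => localInner X (lam q p u) (lam q p v))
    (fun u u' v => by
      simp only [← lamLinear_apply, map_add, localInner, mul_add, add_mul, trace_add])
    (fun c u v => by
      simp only [← lamLinear_apply, map_smul, localInner, mul_smul_comm, smul_mul_assoc,
        trace_smul])
    (fun u v v' => by
      simp only [← lamLinear_apply, map_add, localInner, mul_add, trace_add])
    (fun c u v => by
      simp only [← lamLinear_apply, map_smul, localInner, mul_smul_comm, trace_smul])

theorem lamForm_apply (X : Matrix (Σ i, Fin (L i)) (Σ i, Fin (L i)) ℝ) (u v : Fin U → ℝ) :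
    lamForm q p X u v = localInner X (lam q p u) (lam q p v) := rfl

theorem lamForm_eq_sum (X : Matrix (Σ i, Fin (L i)) (Σ i, Fin (L i)) ℝ) (u v : Fin U → ℝ) :
    lamForm q p X u v =
      ∑ a, ∑ b, u a * v b * lamForm q p X (Pi.single a 1) (Pi.single b 1) := by
  rw [LinearMap.pi_apply_eq_sum_univ (lamForm q p X) u, LinearMap.sum_apply]
  refine Finset.sum_congr rfl fun a _ => ?_
  rw [LinearMap.smul_apply, LinearMap.pi_apply_eq_sum_univ (lamForm q p X _) v, smul_eq_mul,
    Finset.mul_sum]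
  refine Finset.sum_congr rfl fun b _ => ?_
  have e : ∀ c : Fin U, (fun j => if c = j then (1 : ℝ) else 0) = Pi.single c 1 := fun c => by
    funext j; simp [Pi.single_apply, eq_comm]
  rw [e, e, smul_eq_mul, mul_assoc]

theorem dotProduct_hess {x : Fin U → ℝ} (hx : (lam q p x).PosDef) (u v : Fin U → ℝ) :
    u ⬝ᵥ hess q p x *ᵥ v = localInner (lam q p x) (lam q p u) (lam q p v) := by
  rw [← lamForm_apply, lamForm_eq_sum, dotProduct]
  refine Finset.sum_congr rfl fun a _ => ?_
  rw [mulVec, dotProduct, Finset.mul_sum]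
  refine Finset.sum_congr rfl fun b _ => ?_
  rw [hess_apply q p hx, lamForm_apply]
  ring

/-- A point near the gradient certificate is a dual certificate. -/
theorem isDualCertificate_of_near {t x y : Fin U → ℝ} {N : ℝ} (hN : 0 < N)
    (ht : t ∈ interior (cone q)) (hx : (lam q p x).PosDef)
    (hgrad : ∀ h, t ⬝ᵥ h = N * ((lam q p x)⁻¹ * lam q p h).trace)
    (hxy : lamForm q p (lam q p x) (y - x) (y - x) < 1) : IsDualCertificate q p y t := by
  have hsub : lam q p (y - x) = lam q p y - lam q p x := map_sub (lamLinear q p) y x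
  rw [lamForm_apply, hsub] at hxy
  have hy : (lam q p y).PosDef := by
    have := posDef_add hx (by simp [lam_transpose]) hxy
    rwa [add_sub_cancel] at this
  refine ⟨interior_subset ht, mem_interior_dual q p hy, ?_⟩
  have hU : IsUnit (hess q p y) := by
    rw [← mulVec_injective_iff_isUnit]
    refine (injective_iff_map_eq_zero (hess q p y).mulVecLin).2 fun v hv => ?_
    rw [mulVecLin_apply] at hv
    have h0 := dotProduct_hess q p hy v v
    rw [hv, dotProduct_zero] at h0
    exact eq_zero_of_lam_eq_zero q p ht
      (eq_zero_of_localInner_self hy (lam_transpose q p v) h0.symm)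
  set s := (hess q p y)⁻¹ *ᵥ t with hs
  have hHs : hess q p y *ᵥ s = t := by
    rw [hs, mulVec_mulVec, mul_nonsing_inv _ ((isUnit_iff_isUnit_det _).1 hU), one_mulVec]
  set Δ := lam q p (N⁻¹ • s - y) with hΔ
  have hΔT : Δᵀ = Δ := lam_transpose q p _
  have hlam : lam q p (N⁻¹ • s) = lam q p y + Δ := by
    rw [hΔ]
    simp only [← lamLinear_apply]
    rw [← map_add, add_sub_cancel]
  have hyu : IsUnit (lam q p y).det := isUnit_iff_ne_zero.2 hy.det_pos.ne'
  set F := lam q p y * (lam q p x)⁻¹ * lam q p y - lam q p y with hF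
  have hFT : Fᵀ = F := by
    simp [hF, transpose_mul, lam_transpose, transpose_nonsing_inv, mul_assoc]
  -- Δ is the orthogonal projection of F onto the range of Λ: pairing Λ(h) with Λ(N⁻¹s) or with
  -- YX⁻¹Y gives tr(X⁻¹Λ(h)) both times. Only the direction Δ itself is needed.
  have h1 : localInner (lam q p y) F Δ = localInner (lam q p y) Δ Δ := by
    have e1 : localInner (lam q p y) Δ (lam q p (N⁻¹ • s)) = ((lam q p x)⁻¹ * Δ).trace := by
      rw [hΔ, ← dotProduct_hess q p hy, mulVec_smul, hHs, dotProduct_smul, dotProduct_comm,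
        hgrad, smul_eq_mul, inv_mul_cancel_left₀ hN.ne']
    have e2 : localInner (lam q p y) Δ (lam q p (N⁻¹ • s)) =
        ((lam q p y)⁻¹ * Δ).trace + localInner (lam q p y) Δ Δ := by
      rw [hlam, localInner, localInner, mul_add, nonsing_inv_mul _ hyu, mul_add, mul_one,
        trace_add]
    have e3 : localInner (lam q p y) F Δ =
        ((lam q p x)⁻¹ * Δ).trace - ((lam q p y)⁻¹ * Δ).trace := by
      rw [localInner, hF, mul_sub, nonsing_inv_mul _ hyu, sub_mul, one_mul, trace_sub]
      congr 2
      rw [mul_assoc (lam q p y), nonsing_inv_mul_cancel_left _ _ hyu, mul_assoc,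
        mul_nonsing_inv_cancel_left _ _ hyu]
    linarith
  -- Cauchy-Schwarz makes the projection no longer than F, whose length is the distance from x to y
  -- and hence below 1.
  have h2 := localInner_sq_le hy hFT hΔT
  rw [h1, hF, localInner_newton hx hy] at h2
  have h3 : 0 ≤ localInner (lam q p y) Δ Δ := localInner_self_nonneg hy hΔT
  have h4 : localInner (lam q p y) Δ Δ ≤ 1 := by
    by_contra! h
    nlinarith
  have h5 : N⁻¹ • s ∈ dual (cone q) := by
    rw [mem_dual_iff q p, hlam]
    exact posSemidef_add hy hΔT h4
  simpa [smul_smul, hN.ne'] using smul_mem_dual q h5 hN.le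

/-- The local norm scales by 1/N when x is replaced by N x, so the admissible rounding error grows
linearly with N. -/
theorem isDualCertificate_of_near_smul {t x y : Fin U → ℝ} {N : ℝ} (hN : 0 < N)
    (ht : t ∈ interior (cone q)) (hx : (lam q p x).PosDef)
    (hgrad : ∀ h, t ⬝ᵥ h = ((lam q p x)⁻¹ * lam q p h).trace)
    (hxy : lamForm q p (lam q p x) (y - N • x) (y - N • x) < N ^ 2) :
    IsDualCertificate q p y t := by
  have hlam : lam q p (N • x) = N • lam q p x := map_smul (lamLinear q p) N x
  have hinv : (lam q p (N • x))⁻¹ = N⁻¹ • (lam q p x)⁻¹ := by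
    rw [hlam]
    refine inv_eq_left_inv ?_
    rw [smul_mul_smul_comm, inv_mul_cancel₀ hN.ne', one_smul,
      nonsing_inv_mul _ (isUnit_iff_ne_zero.2 hx.det_pos.ne')]
  refine isDualCertificate_of_near q p hN ht (x := N • x) (hlam ▸ hx.smul hN) (fun h => ?_) ?_
  · rw [hinv, smul_mul_assoc, trace_smul, smul_eq_mul, mul_inv_cancel_left₀ hN.ne', hgrad]
  · rw [lamForm_apply, localInner] at hxy ⊢
    rw [hinv]
    simp only [smul_mul_assoc, mul_smul_comm, trace_smul, smul_eq_mul]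
    rw [← mul_assoc, ← mul_inv, ← sq, inv_mul_lt_iff₀ (by positivity), mul_one]
    exact hxy

/-- If the coordinate vectors lie in the dual cone, then the Hessian at the gradient certificate
of `t` is bounded by the norm of `t`. -/
theorem lamForm_self_le {t x h : Fin U → ℝ} {c : ℝ} (hx : (lam q p x).PosDef)
    (hgrad : ∀ h, t ⬝ᵥ h = ((lam q p x)⁻¹ * lam q p h).trace)
    (he : ∀ a, (Pi.single a 1 : Fin U → ℝ) ∈ dual (cone q)) (hh : ∀ a, |h a| ≤ c) :
    lamForm q p (lam q p x) h h ≤ c ^ 2 * (U * ∑ a, t a ^ 2) := by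
  -- Λ(e_a) is positive semidefinite, so its local norm is at most its trace against Λ(x)⁻¹, which
  -- the gradient equation identifies as t_a.
  have hdiag : ∀ a, localInner (lam q p x) (lam q p (Pi.single a 1)) (lam q p (Pi.single a 1)) ≤
      t a ^ 2 := fun a => by
    have h1 := localInner_self_le_trace_sq hx ((mem_dual_iff q p _).1 (he a))
    rwa [← hgrad, dotProduct_single_one] at h1
  have hoff : ∀ a b, |lamForm q p (lam q p x) (Pi.single a 1) (Pi.single b 1)| ≤
      |t a| * |t b| := fun a b => by
    rw [lamForm_apply]
    refine abs_le_of_sq_le_sq ?_ (by positivity)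
    rw [mul_pow, sq_abs, sq_abs]
    refine (localInner_sq_le hx (lam_transpose q p _) (lam_transpose q p _)).trans ?_
    exact mul_le_mul (hdiag a) (hdiag b) (localInner_self_nonneg hx (lam_transpose q p _))
      (sq_nonneg _)
  calc lamForm q p (lam q p x) h h
      ≤ ∑ a, ∑ b, (c * |t a|) * (c * |t b|) := by
        rw [lamForm_eq_sum]
        refine Finset.sum_le_sum fun a _ => Finset.sum_le_sum fun b _ => ?_
        refine (le_abs_self _).trans ?_
        rw [abs_mul, abs_mul, mul_mul_mul_comm]
        have hc : 0 ≤ c := (abs_nonneg _).trans (hh a)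
        exact mul_le_mul (mul_le_mul (hh a) (hh b) (abs_nonneg _) hc) (hoff a b) (abs_nonneg _)
          (by positivity)
    _ = c ^ 2 * (∑ a, |t a|) ^ 2 := by
        rw [← Finset.sum_mul_sum, ← Finset.mul_sum]; ring
    _ ≤ c ^ 2 * (U * ∑ a, t a ^ 2) := by
        refine mul_le_mul_of_nonneg_left ?_ (sq_nonneg c)
        have := sq_sum_le_card_mul_sum_sq (s := Finset.univ) (f := fun a => |t a|)
        simpa using this

end dualCone

/-! ### The interval [-1, 1]: bounds on the dual cone and the Lagrange basis. -/

section interval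

open Matrix

theorem mem_domain_weights {odd : Bool} {x : ℝ} :
    x ∈ domain (weights odd) ↔ x ∈ Set.Icc (-1 : ℝ) 1 := by
  cases odd
  · simp only [domain, weights, Fin.forall_fin_two, Set.mem_ofPred_eq, Set.mem_Icc]
    simp only [cons_val_zero, cons_val_one, eval_one, eval_sub, eval_pow, eval_X, zero_le_one,
      true_and, sub_nonneg]
    rw [sq_le_one_iff_abs_le_one, abs_le]
  · simp only [domain, weights, Fin.forall_fin_two, Set.mem_ofPred_eq, Set.mem_Icc]
    simp only [cons_val_zero, cons_val_one, eval_one, eval_sub, eval_add, eval_X, sub_nonneg]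
    constructor <;> rintro ⟨h1, h2⟩ <;> constructor <;> linarith

theorem abs_eval_le_maxAbs {m U : ℕ} {w : Fin m → ℝ[X]} {L : Fin m → ℕ}
    (q : Module.Basis (Fin U) ℝ (space w L)) (u : Fin U) {x : ℝ} (hx : x ∈ Set.Icc (-1 : ℝ) 1) :
    |(q u : ℝ[X]).eval x| ≤ maxAbs q := by
  have hc : Continuous fun x : Set.Icc (-1 : ℝ) 1 => |(q u : ℝ[X]).eval (x : ℝ)| :=
    ((q u : ℝ[X]).continuous.comp continuous_subtype_val).abs
  exact (le_ciSup (isCompact_range hc).bddAbove ⟨x, hx⟩).trans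
    (le_ciSup (f := fun u => ⨆ x : Set.Icc (-1 : ℝ) 1, |(q u : ℝ[X]).eval (x : ℝ)|)
      (Set.finite_range _).bddAbove u)

theorem dim_pos (odd : Bool) (d : ℕ) : 0 < dim odd d := by cases odd <;> exact Nat.succ_pos _

theorem dim_le (odd : Bool) (d : ℕ) : dim odd d ≤ 2 * d + 2 := by
  cases odd
  · exact Nat.le_succ _
  · exact le_rfl

theorem sum_blockDim (odd : Bool) (d : ℕ) : ∑ i, blockDim odd d i = dim odd d := by
  cases odd <;> simp [blockDim, dim, Fin.sum_univ_two] <;> omega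

theorem blockDim_le (odd : Bool) (d : ℕ) (i : Fin 2) : blockDim odd d i ≤ d + 1 := by
  cases odd <;> fin_cases i <;> simp [blockDim]

theorem weights_eval_pos (odd : Bool) (i : Fin 2) {x : ℝ} (h0 : 0 ≤ x) (h1 : x < 1) :
    0 < (weights odd i).eval x := by
  have h : |x| < 1 := by rwa [abs_of_nonneg h0]
  cases odd <;> fin_cases i <;> simp [weights] <;> linarith

variable {odd : Bool} {d : ℕ}

section basis

variable (q : Module.Basis (Fin (dim odd d)) ℝ (space (weights odd) (blockDim odd d)))

theorem basisVec_mem_dual {x : ℝ} (hx : x ∈ domain (weights odd)) :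
    basisVec q x ∈ dual (cone q) := by
  rw [mem_dual_iff_functional]
  intro i a
  rw [functional_basisVec, weightedSq, eval_mul, eval_mul]
  exact mul_nonneg (hx i) (mul_self_nonneg _)

theorem repr_mem_cone_of_nonneg (r : space (weights odd) (blockDim odd d))
    (hr : ∀ x ∈ Set.Icc (-1 : ℝ) 1, 0 ≤ (r : ℝ[X]).eval x) :
    (q.repr r : Fin (dim odd d) → ℝ) ∈ cone q := by
  have hdeg : (r : ℝ[X]).degree < dim odd d :=
    mem_degreeLT.1 ((space_eq odd d).le r.2)
  have hnat : (r : ℝ[X]).natDegree ≤ dim odd d - 1 := by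
    rcases eq_or_ne (r : ℝ[X]) 0 with h0 | h0
    · simp [h0]
    · exact Nat.le_sub_one_of_lt ((natDegree_lt_iff_degree_lt h0).2 hdeg)
  have h := isWSOS_of_nonneg _ _ hnat hr
  rw [repr_mem_cone_iff]
  cases odd
  · obtain ⟨σ, τ, hσ, hτ, e⟩ := isWSOS_even.1 h
    refine ⟨![σ, τ], Fin.forall_fin_two.2 ⟨hσ, hτ⟩, ?_⟩
    simpa [weights, Fin.sum_univ_two] using e
  · obtain ⟨σ, τ, hσ, hτ, e⟩ := isWSOS_odd.1 h
    refine ⟨![σ, τ], Fin.forall_fin_two.2 ⟨hσ, hτ⟩, ?_⟩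
    simpa [weights, Fin.sum_univ_two] using e

/-- The polynomials μ + q_u and μ - q_u are nonnegative on [-1, 1], hence in Σ; v pairs
nonnegatively with both. -/
theorem abs_le_maxAbs_mul {v : Fin (dim odd d) → ℝ} (hv : v ∈ dual (cone q))
    (u : Fin (dim odd d)) : |v u| ≤ maxAbs q * (q.repr (onePoly odd d) ⬝ᵥ v) := by
  have key : ∀ c : ℝ, |c| = 1 →
      0 ≤ maxAbs q * (q.repr (onePoly odd d) ⬝ᵥ v) + c * v u := fun c hc => by
    have h := hv _ (repr_mem_cone_of_nonneg q (maxAbs q • onePoly odd d + c • q u)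
      fun x hx => by
        have h1 := abs_eval_le_maxAbs q u hx
        have h2 : |c * (q u : ℝ[X]).eval x| ≤ maxAbs q := by rwa [abs_mul, hc, one_mul]
        simp only [onePoly, Submodule.coe_add, Submodule.coe_smul, eval_add, eval_smul, eval_one,
          smul_eq_mul, mul_one]
        linarith [neg_abs_le (c * (q u : ℝ[X]).eval x)])
    rw [← functional_apply, map_add, map_smul, map_smul, functional_apply, functional_apply,
      q.repr_self, smul_eq_mul, smul_eq_mul, Finsupp.single_eq_pi_single,
      single_one_dotProduct] at h
    exact h
  have h1 := key 1 abs_one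
  have h2 := key (-1) (by simp)
  rw [abs_le]
  constructor <;> linarith

/-- The witness is a sum of evaluations at d + 1 distinct points of [0, 1), where all weights are
positive. A nonzero polynomial of degree at most d cannot vanish at all of them. -/
theorem exists_posDef (p : ∀ i, Module.Basis (Fin (blockDim odd d i)) ℝ
    (degreeLT ℝ (blockDim odd d i))) : ∃ v, (lam q p v).PosDef := by
  set x : ℕ → ℝ := fun k => k / (d + 1) with hx
  have hx0 : ∀ k, 0 ≤ x k := fun k => by positivity
  have hx1 : ∀ k ∈ Finset.range (d + 1), x k < 1 := fun k hk => by
    rw [hx, div_lt_one (by positivity)]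
    exact_mod_cast Finset.mem_range.1 hk
  refine ⟨∑ k ∈ Finset.range (d + 1), basisVec q (x k), posDef_lam q p fun i a ha => ?_⟩
  have e : functional q (∑ k ∈ Finset.range (d + 1), basisVec q (x k))
      (weightedSq (weights odd) (blockDim odd d) i a) =
      ∑ k ∈ Finset.range (d + 1), (weights odd i).eval (x k) *
        ((a : ℝ[X]).eval (x k) * (a : ℝ[X]).eval (x k)) := by
    rw [functional_apply, dotProduct_sum]
    refine Finset.sum_congr rfl fun k _ => ?_
    rw [← functional_apply, functional_basisVec, weightedSq, eval_mul, eval_mul]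
  rw [e]
  obtain ⟨k, hk, hak⟩ : ∃ k ∈ Finset.range (d + 1), (a : ℝ[X]).eval (x k) ≠ 0 := by
    by_contra! h
    refine ha (Subtype.ext (eq_zero_of_degree_lt_of_eval_index_eq_zero _ (v := x)
      (fun j _ k _ hjk => ?_) ?_ h))
    · have : (d + 1 : ℝ) ≠ 0 := by positivity
      exact_mod_cast (div_left_inj' this).1 hjk
    · rw [Finset.card_range]
      exact (mem_degreeLT.1 a.2).trans_le (by exact_mod_cast blockDim_le odd d i)
  exact Finset.sum_pos'
    (fun k hk => mul_nonneg (weights_eval_pos odd i (hx0 k) (hx1 k hk)).le (mul_self_nonneg _))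
    ⟨k, hk, mul_pos (weights_eval_pos odd i (hx0 k) (hx1 k hk)) (mul_self_pos.2 hak)⟩

end basis

section lagrange

variable {z : Fin (dim odd d) → ℝ}
  (hz : Unisolvent (space (weights odd) (blockDim odd d)) (Set.range z))

theorem basisVec_lagrange (a : Fin (dim odd d)) :
    basisVec (lagrange odd d z hz) (z a) = Pi.single a 1 := by
  funext u
  rw [basisVec, lagrange_eval, Pi.single_apply]

theorem lagrange_repr (r : space (weights odd) (blockDim odd d)) (a : Fin (dim odd d)) :
    (lagrange odd d z hz).repr r a = (r : ℝ[X]).eval (z a) := by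
  rw [← functional_basisVec (lagrange odd d z hz), basisVec_lagrange, functional_apply,
    dotProduct_single_one]

theorem lagrange_repr_onePoly (a : Fin (dim odd d)) :
    (lagrange odd d z hz).repr (onePoly odd d) a = 1 := by
  rw [lagrange_repr, onePoly, eval_one]

theorem injective_of_unisolvent
    (hz : Unisolvent (space (weights odd) (blockDim odd d)) (Set.range z)) : Function.Injective z := fun a b hab => by
  have h := lagrange_eval odd d z hz a b
  rw [← hab, lagrange_eval] at h
  by_contra hne
  simp [hne] at h

theorem single_mem_dual (hzd : ∀ i, z i ∈ domain (weights odd)) (a : Fin (dim odd d)) :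
    (Pi.single a 1 : Fin (dim odd d) → ℝ) ∈ dual (cone (lagrange odd d z hz)) := by
  rw [← basisVec_lagrange hz]
  exact basisVec_mem_dual _ (hzd a)

theorem one_le_maxAbs (hzd : ∀ i, z i ∈ domain (weights odd)) :
    1 ≤ maxAbs (lagrange odd d z hz) := by
  have h := abs_eval_le_maxAbs (lagrange odd d z hz) ⟨0, dim_pos odd d⟩
    (mem_domain_weights.1 (hzd ⟨0, dim_pos odd d⟩))
  simpa [lagrange_eval] using h

/-- The unit sphere meets the closed dual cone in a compact set, nonempty because it contains a unit
vector. -/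
theorem isLeast_k1 (hzd : ∀ i, z i ∈ domain (weights odd)) (e : Fin (dim odd d) → ℝ) :
    IsLeast (k1Values (lagrange odd d z hz) e) (k1 (lagrange odd d z hz) e) := by
  have himage : k1Values (lagrange odd d z hz) e =
      (fun v => e ⬝ᵥ v) '' (dual (cone (lagrange odd d z hz)) ∩ Metric.sphere 0 1) := by
    ext r
    simp [k1Values, and_assoc, eq_comm]
  have hcomp : IsCompact (k1Values (lagrange odd d z hz) e) := by
    rw [himage]
    exact ((isCompact_sphere _ _).inter_left (isClosed_dual _)).image
      (continuous_const.dotProduct continuous_id)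
  refine hcomp.isLeast_sInf ⟨_, Pi.single ⟨0, dim_pos odd d⟩ 1, single_mem_dual hz hzd _, ?_, rfl⟩
  rw [Pi.norm_single, norm_one]

theorem one_div_maxAbs_le_k1 (hzd : ∀ i, z i ∈ domain (weights odd)) :
    1 / maxAbs (lagrange odd d z hz) ≤
      k1 (lagrange odd d z hz) ((lagrange odd d z hz).repr (onePoly odd d)) := by
  obtain ⟨v, hv, hv1, hk⟩ := (isLeast_k1 hz hzd ((lagrange odd d z hz).repr (onePoly odd d))).1
  have hμ : 0 < maxAbs (lagrange odd d z hz) := zero_lt_one.trans_le (one_le_maxAbs hz hzd)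
  rw [hk, div_le_iff₀' hμ, ← hv1]
  have h := abs_le_maxAbs_mul (lagrange odd d z hz) hv
  exact (pi_norm_le_iff_of_nonneg ((abs_nonneg _).trans (h ⟨0, dim_pos odd d⟩))).2 h

theorem momentMatrix_lagrange :
    momentMatrix (lagrange odd d z hz) z (fun _ => 1) = 1 := by
  ext a b
  simp [momentMatrix, basisVec_lagrange, Matrix.sum_apply, vecMulVec_apply, Pi.single_apply,
    Matrix.one_apply]

theorem cond_one {U : ℕ} (hU : 0 < U) : cond (1 : Matrix (Fin U) (Fin U) ℝ) = 1 := by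
  have : Nonempty (Fin U) := ⟨⟨0, hU⟩⟩
  rw [cond, spectrum.one_eq, csSup_singleton, csInf_singleton, div_one]

/-- The gradient certificate of a polynomial that exceeds `ε` has small coordinates. -/
theorem abs_le_of_gradient {p : ∀ i, Module.Basis (Fin (blockDim odd d i)) ℝ
    (degreeLT ℝ (blockDim odd d i))} (hzd : ∀ i, z i ∈ domain (weights odd))
    {t x : Fin (dim odd d) → ℝ} {ε : ℝ} (hε : 0 < ε)
    (htε : t - ε • (lagrange odd d z hz).repr (onePoly odd d) ∈
      closure (cone (lagrange odd d z hz)))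
    (hx : (lam (lagrange odd d z hz) p x).PosDef)
    (hgrad : ∀ h, t ⬝ᵥ h =
      ((lam (lagrange odd d z hz) p x)⁻¹ * lam (lagrange odd d z hz) p h).trace)
    (u : Fin (dim odd d)) : |x u| ≤ dim odd d * maxAbs (lagrange odd d z hz) / ε := by
  have hμ := one_le_maxAbs hz hzd
  have hxd := (mem_dual_iff (lagrange odd d z hz) p x).2 hx.posSemidef
  have h1 := abs_le_maxAbs_mul (lagrange odd d z hz) hxd u
  have h2 := dotProduct_nonneg_of_mem_closure (lagrange odd d z hz) htε hxd
  -- Since tᵀx is the trace of the identity, whose size is the dimension U, this bounds ε 1ᵀx by U.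
  rw [sub_dotProduct, smul_dotProduct, hgrad,
    nonsing_inv_mul _ (isUnit_iff_ne_zero.2 hx.det_pos.ne'), trace_one, Fintype.card_sigma,
    smul_eq_mul] at h2
  simp only [Fintype.card_fin, sum_blockDim] at h2
  rw [le_div_iff₀ hε]
  nlinarith

end lagrange

end interval

/-! ### Rounding the scaled gradient certificate, and the size bounds. -/

section rounding

open Matrix

/-- A bound R ≥ √2 lets powers of R absorb numerical constants: y ≤ 16 M²R and 16 ≤ R⁸, hence the
exponent 9. -/
theorem log_le_of_le_mul {y M R : ℝ} (hy : 0 ≤ y) (hM : 1 ≤ M) (hR : Real.sqrt 2 ≤ R)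
    (h : y ≤ 1 / 2 + 12 * M ^ 2 * R) : Real.log y ≤ 9 * (Real.log M + Real.log R) := by
  have h2 : 2 ≤ R ^ 2 := by
    rw [← Real.sq_sqrt (zero_le_two (α := ℝ))]
    gcongr
  have hR1 : 1 ≤ R := Real.one_le_sqrt.2 one_le_two |>.trans hR
  have hRM : 1 ≤ M ^ 2 * R := one_le_mul_of_one_le_of_one_le (one_le_pow₀ hM) hR1
  have h8 : 16 ≤ R ^ 8 := by
    calc (16 : ℝ) = 2 ^ 4 := by norm_num
      _ ≤ (R ^ 2) ^ 4 := by gcongr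
      _ = R ^ 8 := by ring
  have hle : y ≤ (M * R) ^ 9 := by
    calc y ≤ 16 * (M ^ 2 * R) := by linarith
      _ ≤ R ^ 8 * (M ^ 9 * R) := by gcongr; norm_num
      _ = (M * R) ^ 9 := by ring
  have hlog : 9 * (Real.log M + Real.log R) = Real.log ((M * R) ^ 9) := by
    rw [Real.log_pow, Real.log_mul (by positivity) (by positivity)]
    norm_num
  rw [hlog]
  -- For y = 0 the convention `Real.log 0 = 0` is used.
  rcases hy.eq_or_lt with h0 | h0
  · rw [← h0, Real.log_zero]
    exact Real.log_nonneg (one_le_pow₀ (one_le_mul_of_one_le_of_one_le hM hR1))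
  · exact Real.log_le_log h0 hle

variable {odd : Bool} {d : ℕ} {z : Fin (dim odd d) → ℝ}
  (hz : Unisolvent (space (weights odd) (blockDim odd d)) (Set.range z))

/-- The coordinates of t are its values at the nodes, where t - ε is nonnegative. -/
theorem le_apply_of_sub_mem_closure (hzd : ∀ i, z i ∈ domain (weights odd))
    {t : Fin (dim odd d) → ℝ} {ε : ℝ}
    (htε : t - ε • (lagrange odd d z hz).repr (onePoly odd d) ∈
      closure (cone (lagrange odd d z hz))) (u : Fin (dim odd d)) : ε ≤ t u := by
  have h := dotProduct_nonneg_of_mem_closure _ htε (single_mem_dual hz hzd u)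
  rw [dotProduct_single_one, Pi.sub_apply, Pi.smul_apply, lagrange_repr_onePoly] at h
  simpa using h

theorem exists_integer_dualCertificate (hzd : ∀ i, z i ∈ domain (weights odd))
    (p : ∀ i, Module.Basis (Fin (blockDim odd d i)) ℝ (degreeLT ℝ (blockDim odd d i)))
    {t : Fin (dim odd d) → ℝ} (ht : t ∈ interior (cone (lagrange odd d z hz)))
    {ε : ℝ} (hε : 0 < ε)
    (htε : t - ε • (lagrange odd d z hz).repr (onePoly odd d) ∈
      closure (cone (lagrange odd d z hz))) :
    ∃ y : Fin (dim odd d) → ℤ,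
      IsDualCertificate (lagrange odd d z hz) p (fun i => (y i : ℝ)) t ∧
      ‖fun i => (y i : ℝ)‖ ≤ 1 / 2 + 3 / 2 * Real.sqrt (2 * d + 2) * ‖WithLp.toLp 2 t‖ *
        ((2 * d + 2) * maxAbs (lagrange odd d z hz) / ε) ∧
      Real.log ‖fun i => (y i : ℝ)‖ ≤
        9 * (Real.log (max 1 d) + Real.log ‖WithLp.toLp 2 t‖ +
          Real.log (maxAbs (lagrange odd d z hz)) + Real.log (1 / ε)) := by
  set q := lagrange odd d z hz
  set μ := maxAbs q
  have hμ : 1 ≤ μ := one_le_maxAbs hz hzd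
  have hdim : ((dim odd d : ℕ) : ℝ) ≤ 2 * d + 2 := by exact_mod_cast dim_le odd d
  have : Nonempty (Fin (dim odd d)) := ⟨⟨0, dim_pos odd d⟩⟩
  have : Nonempty (Σ i, Fin (blockDim odd d i)) := by
    rw [← Fintype.card_pos_iff, Fintype.card_sigma]
    simpa only [Fintype.card_fin, sum_blockDim] using dim_pos odd d
  obtain ⟨v₀, hv₀⟩ := exists_posDef q p
  obtain ⟨x, hx, hgrad⟩ := exists_gradient_certificate q p ht hv₀
  have hxle := abs_le_of_gradient hz hzd hε htε hx hgrad
  have hεt : ∀ u, ε ≤ t u := le_apply_of_sub_mem_closure hz hzd htε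
  set T := ‖WithLp.toLp 2 t‖ with hT
  have hTsq : T ^ 2 = ∑ a, t a ^ 2 := by
    rw [hT, EuclideanSpace.real_norm_sq_eq]
  have hTε : (dim odd d : ℝ) * ε ^ 2 ≤ T ^ 2 := by
    have h := Finset.card_nsmul_le_sum Finset.univ (fun u => t u ^ 2) (ε ^ 2)
      fun u _ => pow_le_pow_left₀ hε.le (hεt u) 2
    rwa [Finset.card_univ, Fintype.card_fin, nsmul_eq_mul, ← hTsq] at h
  have hT0 : 0 < T := by
    have : 0 < T ^ 2 := lt_of_lt_of_le
      (mul_pos (by exact_mod_cast dim_pos odd d) (pow_pos hε 2)) hTε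
    exact (norm_nonneg _).lt_of_ne fun h => by rw [hT, ← h] at this; simp at this
  have hsqrt : 1 ≤ Real.sqrt (2 * d + 2) := Real.one_le_sqrt.2 (by
    have : (0 : ℝ) ≤ d := Nat.cast_nonneg d
    linarith)
  -- In dimension one t can equal ε with μ = 1; the logarithmic bound is then 0, leaving no room for
  -- a constant and forcing the norm of y to be at most 1.
  rcases (Nat.succ_le_of_lt (dim_pos odd d)).eq_or_lt with h1 | h2
  · -- in dimension one, every positive number is a dual certificate
    have hsub : ∀ a b : Fin (dim odd d), a = b := fun a b => by
      apply Fin.ext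
      omega
    have hR : ε ≤ T := by
      have hTε' : ε ^ 2 ≤ T ^ 2 := by rw [← h1] at hTε; simpa using hTε
      exact (sq_le_sq₀ hε.le hT0.le).1 hTε'
    refine ⟨fun _ => 1, ?_, ?_, ?_⟩
    · have u₀ : Fin (dim odd d) := ⟨0, dim_pos odd d⟩
      refine isDualCertificate_of_near_smul q p (N := t u₀) (hε.trans_le (hεt u₀)) ht hx hgrad ?_
      -- With N = t, the point N x is exactly 1, so there is no rounding error.
      have htx : t u₀ * x u₀ = 1 := by
        have h := hgrad x
        rw [nonsing_inv_mul _ (isUnit_iff_ne_zero.2 hx.det_pos.ne'), trace_one,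
          Fintype.card_sigma] at h
        simp only [Fintype.card_fin, sum_blockDim] at h
        rw [dotProduct, Finset.sum_eq_single u₀ (fun b _ hb => absurd (hsub b u₀) hb)
          (fun hb => absurd (Finset.mem_univ u₀) hb)] at h
        rw [h, ← h1]
        simp
      have : (fun _ => ((1 : ℤ) : ℝ)) - t u₀ • x = 0 := by
        funext u
        rw [hsub u u₀, Pi.sub_apply, Pi.smul_apply, smul_eq_mul, htx]
        simp
      rw [this, map_zero]
      exact pow_pos (hε.trans_le (hεt u₀)) 2
    · have e : ‖fun _ : Fin (dim odd d) => ((1 : ℤ) : ℝ)‖ = 1 := by simp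
      rw [e]
      have hTε1 : 1 ≤ T * (1 / ε) := by rw [mul_one_div, one_le_div hε]; exact hR
      have h3 : 1 ≤ Real.sqrt (2 * d + 2) * ((2 * d + 2) * μ) :=
        one_le_mul_of_one_le_of_one_le hsqrt
          (one_le_mul_of_one_le_of_one_le (by linarith) hμ)
      have h4 := one_le_mul_of_one_le_of_one_le hTε1 h3
      have h5 : 3 / 2 * Real.sqrt (2 * d + 2) * T * ((2 * d + 2) * μ / ε) =
        3 / 2 * (T * (1 / ε) * (Real.sqrt (2 * d + 2) * ((2 * d + 2) * μ))) := by ring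
      rw [h5]
      linarith
    · have e : ‖fun _ : Fin (dim odd d) => ((1 : ℤ) : ℝ)‖ = 1 := by simp
      rw [e, Real.log_one, one_div, Real.log_inv]
      have h3 : 0 ≤ Real.log (max 1 (d : ℝ)) := Real.log_nonneg (le_max_left _ _)
      have h4 : 0 ≤ Real.log μ := Real.log_nonneg hμ
      have h5 : Real.log ε ≤ Real.log T := Real.log_le_log hε hR
      linarith
  -- The rounding error has local norm at most ½√U T at x, so this N exceeds it by a factor of at
  -- least three.
  · set N := 3 / 2 * Real.sqrt (2 * d + 2) * T with hN
    have hN0 : 0 < N := by positivity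
    have hNsq : N ^ 2 = 9 / 4 * (2 * d + 2) * T ^ 2 := by
      rw [hN, mul_pow, mul_pow, Real.sq_sqrt (by positivity)]
      ring
    set y : Fin (dim odd d) → ℤ := fun u => round (N * x u) with hy
    have hround : ∀ u, |(y u : ℝ) - N * x u| ≤ 1 / 2 := fun u => by
      rw [abs_sub_comm]
      exact abs_sub_round _
    have hnorm : ‖fun i => (y i : ℝ)‖ ≤ 1 / 2 + N * ((2 * d + 2) * μ / ε) := by
      refine (pi_norm_le_iff_of_nonneg (by positivity)).2 fun u => ?_
      have e1 : |x u| ≤ (2 * d + 2) * μ / ε := (hxle u).trans (by gcongr)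
      have e2 : |N * x u| ≤ N * ((2 * d + 2) * μ / ε) := by
        rw [abs_mul, abs_of_pos hN0]
        gcongr
      calc ‖(y u : ℝ)‖ = |((y u : ℝ) - N * x u) + N * x u| := by
            rw [sub_add_cancel, Real.norm_eq_abs]
        _ ≤ |(y u : ℝ) - N * x u| + |N * x u| := abs_add_le _ _
        _ ≤ _ := add_le_add (hround u) e2
    refine ⟨y, ?_, hnorm, ?_⟩
    · refine isDualCertificate_of_near_smul q p hN0 ht hx hgrad ?_
      refine (lamForm_self_le q p hx hgrad (single_mem_dual hz hzd) hround).trans_lt ?_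
      rw [← hTsq, hNsq]
      have := mul_le_mul_of_nonneg_right hdim (sq_nonneg T)
      have : 0 < (2 * d + 2) * T ^ 2 := by positivity
      linarith
    · have hM1 : (1 : ℝ) ≤ max 1 (d : ℝ) := le_max_left _ _
      have hMd : (d : ℝ) ≤ max 1 (d : ℝ) := le_max_right _ _
      set M := max 1 (d : ℝ)
      -- Every t_u is at least ε and there are at least two coordinates, so T ≥ √2 ε.
      have hR : Real.sqrt 2 ≤ T * μ / ε := by
        have hcard : (2 : ℝ) ≤ dim odd d := by exact_mod_cast h2
        rw [le_div_iff₀ hε]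
        have e : Real.sqrt 2 * ε ≤ T := by
          refine (sq_le_sq₀ (by positivity) hT0.le).1 ?_
          rw [mul_pow, Real.sq_sqrt zero_le_two]
          exact (mul_le_mul_of_nonneg_right hcard (sq_nonneg ε)).trans hTε
        exact e.trans (le_mul_of_one_le_right hT0.le hμ)
      have hsqrtM : Real.sqrt (2 * d + 2) ≤ 2 * M := by
        rw [Real.sqrt_le_left (by positivity)]
        nlinarith
      have h := log_le_of_le_mul (norm_nonneg _) hM1 hR (hnorm.trans (by
        have e : N * ((2 * d + 2) * μ / ε) =
          3 / 2 * (Real.sqrt (2 * d + 2) * (2 * d + 2)) * (T * μ / ε) := by rw [hN]; ring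
        rw [e]
        have e2 : Real.sqrt (2 * d + 2) * (2 * d + 2) ≤ (2 * M) * (4 * M) := by
          gcongr
          linarith
        have : 3 / 2 * (Real.sqrt (2 * d + 2) * (2 * d + 2)) ≤ 12 * M ^ 2 := by nlinarith
        gcongr))
      rw [Real.log_div (by positivity) hε.ne', Real.log_mul hT0.ne' (by positivity)] at h
      rw [one_div, Real.log_inv]
      linarith

end rounding

end WSOS

theorem mainTheorem9 :
    ∃ C : ℝ, 0 < C ∧
      ∀ (odd : Bool) (d : ℕ) (z : Fin (WSOS.dim odd d) → ℝ)
        (_ : ∀ i, z i ∈ WSOS.domain (WSOS.weights odd))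
        (hz : WSOS.Unisolvent (WSOS.space (WSOS.weights odd) (WSOS.blockDim odd d)) (Set.range z))
        (p : ∀ i, Module.Basis (Fin (WSOS.blockDim odd d i)) ℝ
          (Polynomial.degreeLT ℝ (WSOS.blockDim odd d i))),
        let q := WSOS.lagrange odd d z hz
        let one : Fin (WSOS.dim odd d) → ℝ := q.repr (WSOS.onePoly odd d)
        let μ := WSOS.maxAbs q
        -- the constant `k₁`, a minimum, is at least `1 / μ`
        (IsLeast (WSOS.k1Values q one) (WSOS.k1 q one) ∧ 1 / μ ≤ WSOS.k1 q one) ∧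
        -- the matrix `M` can be chosen to be the identity matrix
        (∃ (s : ℕ) (x α : Fin s → ℝ), WSOS.dim odd d ≤ s ∧ Function.Injective x ∧
          (∀ a, x a ∈ WSOS.domain (WSOS.weights odd)) ∧
          WSOS.Unisolvent (WSOS.space (WSOS.weights odd) (WSOS.blockDim odd d)) (Set.range x) ∧
          (∀ a, 0 < α a) ∧
          WSOS.momentMatrix q x α = 1 ∧ WSOS.cond (WSOS.momentMatrix q x α) = 1) ∧
        -- integer dual certificates
        (∀ t ∈ interior (WSOS.cone q), ∀ ε : ℝ, 0 < ε →
          t - ε • one ∈ frontier (WSOS.cone q) →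
          ∃ y : Fin (WSOS.dim odd d) → ℤ,
            WSOS.IsDualCertificate q p (fun i => (y i : ℝ)) t ∧
            ‖fun i => (y i : ℝ)‖ ≤ 1 / 2 +
              (⌈3 / 2 * Real.sqrt (2 * d + 2) * ‖WithLp.toLp 2 t‖⌉ : ℝ) *
                ((2 * d + 2) * μ / ε) ∧
            Real.log ‖fun i => (y i : ℝ)‖ ≤
              C * (Real.log (max 1 d) + Real.log ‖WithLp.toLp 2 t‖ + Real.log μ +
                Real.log (1 / ε))) := by
  refine ⟨9, by norm_num, fun odd d z hzd hz p => ⟨⟨?_, ?_⟩, ?_, fun t ht ε hε htε => ?_⟩⟩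
  · exact WSOS.isLeast_k1 hz hzd _
  · exact WSOS.one_div_maxAbs_le_k1 hz hzd
  -- At the nodes the vectors q(z_a) are the unit vectors, so unit weights give the identity.
  · refine ⟨_, z, fun _ => 1, le_rfl, WSOS.injective_of_unisolvent hz, hzd, hz,
      fun _ => one_pos, WSOS.momentMatrix_lagrange hz, ?_⟩
    rw [WSOS.momentMatrix_lagrange hz]
    exact WSOS.cond_one (WSOS.dim_pos odd d)
  -- Of the boundary condition only membership in the closure of Σ is needed; the ceiling merely
  -- enlarges the norm bound.
  · obtain ⟨y, hy, hnorm, hlog⟩ := WSOS.exists_integer_dualCertificate hz hzd p ht hε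
      (frontier_subset_closure htε)
    have hμ := WSOS.one_le_maxAbs hz hzd
    exact ⟨y, hy, hnorm.trans (by gcongr; exact Int.le_ceil _), hlog⟩
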